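/- Let $K$ and $L$ be imaginary quadratic number fields, neither of which is isomorphic to $\mathbf{Q}(i)$ or to $\mathbf{Q}(\sqrt{-2})$. Write $\mathbf{A}_K$ for the adele ring of $K$, $\mathbf{A}_{K,f}$ for its ring of finite adeles, and $\mathbf{A}_K^*$, $\mathbf{A}_{K,f}^*$ for their unit groups with the idelic topology (the topology induced by $x \mapsto (x, x^{-1})$), and similarly for $L$. Then for all integers $r, s \geq 0$ there are isomorphisms of topological groups $$(\mathbf{A}_{K,f},+)^r \times (\mathbf{A}_{K,f}^*,\cdot)^s \cong (\mathbf{A}_{L,f},+)^r \times (\mathbf{A}_{L,f}^*,\cdot)^s$$ and $$(\mathbf{A}_{K},+)^r \times (\mathbf{A}_{K}^*,\cdot)^s \cong (\mathbf{A}_{L},+)^r \times (\mathbf{A}_{L}^*,\cdot)^s.$$ On the other hand, if $K$ and $L$ are not isomorphic as fields, then $\mathbf{A}_{K,f} \not\cong \mathbf{A}_{L,f}$ and $\mathbf{A}_K \not\cong \mathbf{A}_L$ as rings (and hence not as topological rings either). -/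

import Mathlib

/-- An imaginary quadratic field: a number field of degree `2` over `ℚ` all of whose archimedean
places are complex. -/
def IsImaginaryQuadratic (K : Type*) [Field K] [NumberField K] : Prop :=
  Module.finrank ℚ K = 2 ∧ NumberField.IsTotallyComplex K

/-- The field `ℚ(i)`, as a subfield of `ℂ`. -/
noncomputable abbrev QI : IntermediateField ℚ ℂ :=
  IntermediateField.adjoin ℚ {Complex.I}

/-- The field `ℚ(√-2)`, as a subfield of `ℂ`. -/
noncomputable abbrev QSqrtNegTwo : IntermediateField ℚ ℂ :=
  IntermediateField.adjoin ℚ {(Real.sqrt 2 : ℂ) * Complex.I}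

/-- The ring of finite adeles of a number field: the restricted product of its completions at the
finite primes, with the restricted product topology. -/
abbrev FiniteAdeles (K : Type*) [Field K] [NumberField K] : Type _ :=
  IsDedekindDomain.FiniteAdeleRing (NumberField.RingOfIntegers K) K

/-- The full adele ring of a number field. -/
abbrev Adeles (K : Type*) [Field K] [NumberField K] : Type _ :=
  NumberField.AdeleRing (NumberField.RingOfIntegers K) K

/-- The group `(A, +)^r × (Aˣ, ·)^s` attached to a topological ring `A`, written multiplicatively:
the group `G(A)` for `G = 𝔾ₐ^r × 𝔾ₘ^s`. The topology is the product topology, where `Aˣ` has the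
topology of the unit group (that of `{(x, y) : x * y = 1}` inside `A × A`). -/
abbrev AddMulPoints (A : Type*) [Ring A] (r s : ℕ) : Type _ :=
  (Fin r → Multiplicative A) × (Fin s → Aˣ)

/-!
The additive group of the finite adeles. For a quadratic field `K` and a prime `p` the product `R_p`
of the local integers above `p` is a free `ℤ_p`-module of rank `2`, so the integral adeles are
additively `∏ p, ℤ_p²`, independently of `K`. The finite adeles are the localization of this open
subgroup at the nonzero integers, hence do not depend on `K` either
(`FiniteAdeles.nonempty_continuousAddEquiv`).

The ideles. The unit group of `R_p` has the open subgroup `1 + p² R_p ≅ ℤ_p²` and is compact;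
hence it is the product of `ℤ_p²` and a finite group (`IsPadicOrder.nonempty_units_equiv`). The
isomorphism `1 + p² R_p ≅ ℤ_p²` is not obtained from a logarithm, but from the criterion
`nonempty_continuousAddEquiv_padicPi`, which recognizes `ℤ_p^ι` among complete groups by a
filtration that multiplication by `p` shifts by one. Thus the integral ideles are
`(∏ p, ℤ_p²) × ∏ i, ℤ/n_i` with prime powers `n_i`, and the countable product of finite cyclic groups is determined
by how often each prime power occurs. Every prime power `ℓ ^ (k + 1)` occurs infinitely often:
when `p ≠ ℓ` splits in `K` and `p - 1` is exactly divisible by `ℓ ^ (k + 1)`, the group `R_pˣ` has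
such a factor (`IsPadicOrder.exists_primePow_eq`), and there are infinitely many such `p` by
Dirichlet's theorem (`exists_prime_jacobiSym_eq_one`). For `ℓ = 2` this needs an odd prime factor
`q` of the squarefree integer `d` with `K = ℚ(√d)`, since a congruence condition modulo `q` must
compensate for the value of the quadratic character on a class modulo a power of `2`. Such a `q`
exists except for `ℚ(i)` and `ℚ(√-2)`. Finally the finite ideles are the product of the integral
ideles and a free abelian group on the countably infinite set of finite places
(`FiniteAdeles.nonempty_units_equiv`), and the infinite adeles are `ℂ` for all imaginary quadratic
fields.

The ring structure. If `K = ℚ(√d)` and `L = ℚ(√d')` are not isomorphic, then up to exchanging them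
some prime divides `d` but not `d'`, so that there are large primes `p` with `(d/p) = -1` and
`(d'/p) = 1` (`exists_prime_jacobiSym_eq_neg_one_and_eq_one`). The Frobenius is then trivial on the
local integers of `L` above `p` modulo `p`, so that these contain no square root of `d`
(`IsSqrtGenerator.exists_forall_jacobiSym_ne`), while a ring isomorphism of adele rings would carry
`√d ∈ K` to such a square root.
-/

/-! ### Additive groups that look like a power of the p-adic integers -/

section

open Filter Topology

/-- A homomorphism on a dense subgroup of `G` that is continuous for the induced topology extends to
`G`. Continuity is stated in `hf` without putting a topology on `A`. -/
theorem AddMonoidHom.exists_continuous_extension_of_denseRange {A G W : Type*} [AddCommGroup A]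
    [AddCommGroup G] [UniformSpace G] [IsUniformAddGroup G]
    [AddCommGroup W] [UniformSpace W] [IsUniformAddGroup W] [CompleteSpace W] [T2Space W]
    (i : A →+ G) (hi : DenseRange i) (f : A →+ W)
    (hf : ∀ U ∈ 𝓝 (0 : W), ∃ V ∈ 𝓝 (0 : G), ∀ a, i a ∈ V → f a ∈ U) :
    ∃ F : G →+ W, Continuous F ∧ ∀ a, F (i a) = f a := by
  let _ : UniformSpace A := UniformSpace.comap i inferInstance
  have : IsUniformAddGroup A := IsUniformAddGroup.comap i
  have hind : IsUniformInducing i := ⟨rfl⟩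
  have hfu : UniformContinuous f := by
    refine uniformContinuous_of_tendsto_zero ?_
    intro U hU
    obtain ⟨V, hV, h⟩ := hf U hU
    rw [hind.isInducing.nhds_eq_comap, map_zero]
    exact ⟨V, hV, h⟩
  have hc := (uniformContinuous_uniformly_extend hind hi hfu).continuous
  have he := fun a => uniformly_extend_of_ind hind hi hfu a
  refine ⟨AddMonoidHom.mk' ((hind.isDenseInducing hi).extend f) ?_, hc, he⟩
  refine hi.induction_on₂ (isClosed_eq (by fun_prop) (by fun_prop)) fun a b => ?_
  rw [← map_add, he, he, he, map_add]

section PadicLattice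

variable {p : ℕ} [hp : Fact p.Prime] {ι : Type*}

theorem PadicInt.isOpen_span_pow (n : ℕ) :
    IsOpen {x : ℤ_[p] | (p : ℤ_[p]) ^ n ∣ x} := by
  have : {x : ℤ_[p] | (p : ℤ_[p]) ^ n ∣ x} = {x : ℤ_[p] | ‖x‖ < (p : ℝ) ^ (-(n : ℤ) + 1)} := by
    ext x
    rw [Set.mem_ofPred_eq, Set.mem_ofPred_eq, ← PadicInt.norm_le_pow_iff_norm_lt_pow_add_one,
      PadicInt.norm_le_pow_iff_mem_span_pow, Ideal.mem_span_singleton]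
  rw [this]
  exact isOpen_lt continuous_norm continuous_const

/-- The coordinatewise embedding of `ℤ^ι` into `ℤ_p^ι`. -/
noncomputable def intCastPadicPi (p : ℕ) [Fact p.Prime] (ι : Type*) : (ι → ℤ) →+ (ι → ℤ_[p]) where
  toFun x i := x i
  map_zero' := by ext; simp
  map_add' x y := by ext; simp

theorem denseRange_intCastPadicPi : DenseRange (intCastPadicPi p ι) :=
  DenseRange.piMap (f := fun _ : ι => (Int.cast : ℤ → ℤ_[p])) fun _ => PadicInt.denseRange_intCast

theorem pow_dvd_mem_nhds_zero [Finite ι] (n : ℕ) :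
    {x : ι → ℤ_[p] | ∀ i, (p : ℤ_[p]) ^ n ∣ x i} ∈ 𝓝 (0 : ι → ℤ_[p]) := by
  refine IsOpen.mem_nhds ?_ (by simp)
  rw [Set.ofPred_forall]
  exact isOpen_iInter_of_finite fun i =>
    (PadicInt.isOpen_span_pow (p := p) n).preimage (continuous_apply (A := fun _ : ι => ℤ_[p]) i)

theorem PadicInt.pow_dvd_intCast {n : ℕ} {k : ℤ} :
    (p : ℤ_[p]) ^ n ∣ (k : ℤ_[p]) ↔ (p : ℤ) ^ n ∣ k := by
  rw [← Ideal.mem_span_singleton, ← PadicInt.norm_le_pow_iff_mem_span_pow,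
    PadicInt.norm_int_le_pow_iff_dvd]

/-- Every `p`-adic integer vector is an integer vector up to a multiple of `p`. -/
theorem exists_intCastPadicPi_add_smul (x : ι → ℤ_[p]) :
    ∃ (n : ι → ℤ) (y : ι → ℤ_[p]), x = intCastPadicPi p ι n + p • y := by
  have h := fun i => PadicInt.appr_spec 1 (x i)
  simp only [pow_one, Ideal.mem_span_singleton] at h
  choose y hy using h
  refine ⟨fun i => ((x i).appr 1 : ℤ), y, funext fun i => ?_⟩
  have h2 : (p • y) i = p * y i := by simp
  rw [Pi.add_apply, h2, ← hy i]
  simp [intCastPadicPi]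

/-- A complete group with a filtration by open subgroups whose graded pieces are `𝔽_p`-vector
spaces with the same basis in every degree, multiplication by `p` shifting the degree, is
`ℤ_p^ι`. -/
theorem nonempty_continuousAddEquiv_padicPi [Fintype ι] {W : Type*} [AddCommGroup W]
    [UniformSpace W]
    [IsUniformAddGroup W] [CompleteSpace W] [T2Space W] (F : ℕ → AddSubgroup W) (b : ι → W)
    (hF0 : F 0 = ⊤)
    (hbasis : ∀ U ∈ 𝓝 (0 : W), ∃ m, (F m : Set W) ⊆ U)
    (hp : ∀ m, ∀ w ∈ F m, p • w ∈ F (m + 1))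
    (hsurj : ∀ m, ∀ w ∈ F m, ∃ x : ι → ℤ, w - p ^ m • ∑ i, x i • b i ∈ F (m + 1))
    (hinj : ∀ m (x : ι → ℤ), p ^ m • ∑ i, x i • b i ∈ F (m + 1) → ∀ i, (p : ℤ) ∣ x i) :
    Nonempty ((ι → ℤ_[p]) ≃ₜ+ W) := by
  have hpow : ∀ m (w : W), p ^ m • w ∈ F m := by
    intro m w
    induction m with
    | zero => simp [hF0]
    | succ m ih => rw [pow_succ', mul_smul]; exact hp m _ ih
  let f : (ι → ℤ) →+ W :=
    { toFun := fun x => ∑ i, x i • b i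
      map_zero' := by simp
      map_add' := fun x y => by simp [add_smul, Finset.sum_add_distrib] }
  obtain ⟨Ψ, hΨc, hΨ⟩ := AddMonoidHom.exists_continuous_extension_of_denseRange
    (intCastPadicPi p ι) denseRange_intCastPadicPi f (by
      intro U hU
      obtain ⟨m, hm⟩ := hbasis U hU
      refine ⟨_, pow_dvd_mem_nhds_zero m, fun x hx => hm ?_⟩
      have hx' : ∀ i, (p : ℤ) ^ m ∣ x i := fun i => PadicInt.pow_dvd_intCast.1 (hx i)
      choose y hy using hx'
      have : x = p ^ m • y := by
        ext i; simp [hy i]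
      rw [this, map_nsmul]
      exact hpow m _)
  -- An element of the kernel is divisible by every power of `p`: reduce a quotient modulo `p` and
  -- apply `hinj`.
  have hinj' : Function.Injective Ψ := by
    rw [injective_iff_map_eq_zero]
    intro x hx
    have key : ∀ m, ∃ y : ι → ℤ_[p], x = p ^ m • y := by
      intro m
      induction m with
      | zero => exact ⟨x, by simp⟩
      | succ m ih =>
        obtain ⟨y, hy⟩ := ih
        obtain ⟨n, z, hz⟩ := exists_intCastPadicPi_add_smul y
        have h1 : p ^ m • f n + p ^ (m + 1) • Ψ z = 0 := by
          rw [← hx, hy, hz, map_nsmul, map_add, hΨ, map_nsmul, smul_add, pow_succ, mul_smul]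
        have h2 : p ^ m • f n ∈ F (m + 1) := by
          rw [eq_neg_of_add_eq_zero_left h1]
          exact neg_mem (hpow _ _)
        choose n' hn' using hinj m n h2
        refine ⟨intCastPadicPi p ι n' + z, ?_⟩
        rw [hy, hz, pow_succ, mul_smul, smul_add p]
        congr 2
        ext i
        simp [intCastPadicPi, hn' i]
    ext i
    by_contra hne
    have hne' : x i ≠ 0 := hne
    obtain ⟨y, hy⟩ := key ((x i).valuation + 1)
    have h3 : x i = (p : ℤ_[p]) ^ ((x i).valuation + 1) * y i := by
      conv_lhs => rw [hy]
      simp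
    have h4 := (PadicInt.mem_span_pow_iff_le_valuation (x i) hne' ((x i).valuation + 1)).1
      (Ideal.mem_span_singleton.2 ⟨_, h3⟩)
    omega
  have hdense : ∀ m w, ∃ x, w - Ψ x ∈ F m := by
    intro m w
    induction m with
    | zero => exact ⟨0, by simp [hF0]⟩
    | succ m ih =>
      obtain ⟨x, hx⟩ := ih
      obtain ⟨y, hy⟩ := hsurj m _ hx
      refine ⟨x + p ^ m • intCastPadicPi p ι y, ?_⟩
      rw [map_add, map_nsmul, hΨ, ← sub_sub]
      exact hy
  -- The image is dense by successive approximation, and it is compact.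
  have hsurj' : Function.Surjective Ψ := by
    have hcl : IsClosed (Set.range Ψ) := (isCompact_range hΨc).isClosed
    intro w
    have : w ∈ closure (Set.range Ψ) := by
      rw [mem_closure_iff_nhds_zero]
      intro U hU
      obtain ⟨m, hm⟩ := hbasis U hU
      obtain ⟨x, hx⟩ := hdense m w
      refine ⟨_, ⟨x, rfl⟩, hm ?_⟩
      have := neg_mem hx
      rwa [neg_sub] at this
    rwa [hcl.closure_eq] at this
  let e : (ι → ℤ_[p]) ≃+ W := AddEquiv.ofBijective Ψ ⟨hinj', hsurj'⟩
  exact ⟨{ e with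
    continuous_toFun := hΨc
    continuous_invFun :=
      (Continuous.homeoOfEquivCompactToT2 (f := e.toEquiv) hΨc).symm.continuous }⟩

end PadicLattice

end

/-! ### Splitting off a free p-adic part of finite index -/

section

open Filter Topology

section Splitting

variable {p : ℕ} [hp : Fact p.Prime] {ι : Type*} [Finite ι]

/-- A compact group with an open subgroup `ℤ_p^ι` maps onto `ℤ_p^ι` with finite kernel. The map is
multiplication by the index of the subgroup, followed by an identification of its image, a closed
subgroup of finite index in `ℤ_p^ι`, with `ℤ_p^ι`. -/
theorem exists_surjective_padicPi_of_open_addSubgroup {V : Type*} [AddCommGroup V]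
    [TopologicalSpace V] [IsTopologicalAddGroup V] [CompactSpace V]
    (W : AddSubgroup V) (hW : IsOpen (W : Set V)) (g : W ≃ₜ+ (ι → ℤ_[p])) :
    ∃ θ : V →+ (ι → ℤ_[p]), Continuous θ ∧ Function.Surjective θ ∧ Finite θ.ker := by
  cases nonempty_fintype ι
  have : Finite (V ⧸ W) := AddSubgroup.quotient_finite_of_isOpen W hW
  set e := W.index with he
  have he0 : e ≠ 0 := AddSubgroup.index_ne_zero_of_finite
  let φ : V →+ W := (nsmulAddMonoidHom e).codRestrict W fun x => W.nsmul_index_mem x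
  have hφc : Continuous φ := by
    refine Continuous.subtype_mk (f := fun x : V => e • x) ?_ _
    exact continuous_const_smul e
  let θ₀ : V →+ (ι → ℤ_[p]) := (g : W →+ (ι → ℤ_[p])).comp φ
  have hθc : Continuous θ₀ := g.continuous.comp hφc
  have htf : ∀ x : ι → ℤ_[p], e • x = 0 → x = 0 := by
    intro x hx
    rcases smul_eq_zero.1 hx with h | h
    · exact absurd h he0
    · exact h
  have hker : Finite θ₀.ker := by
    refine Finite.of_injective (fun k : θ₀.ker => (QuotientAddGroup.mk (k : V) : V ⧸ W)) ?_
    intro k k' hkk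
    have h1 : -(k : V) + k' ∈ W := QuotientAddGroup.eq.1 hkk
    have hz : θ₀ (-(k : V) + k') = 0 := by
      have h2 : θ₀ (k : V) = 0 := k.2
      have h3 : θ₀ (k' : V) = 0 := k'.2
      rw [map_add, map_neg, h2, h3]; simp
    have h4 : φ (-(k : V) + k') = e • (⟨_, h1⟩ : W) := rfl
    have h5 : g (⟨_, h1⟩ : W) = 0 := htf _ (by
      rw [← map_nsmul, ← h4]; exact hz)
    have h6 : (⟨_, h1⟩ : W) = 0 := g.injective (h5.trans (map_zero g).symm)
    have h7 : -(k : V) + k' = 0 := congrArg Subtype.val h6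
    exact Subtype.ext (neg_add_eq_zero.1 h7)
  have hcl : IsClosed (Set.range θ₀) := (isCompact_range hθc).isClosed
  -- The image of `θ₀` is closed, hence a `ℤ_p`-submodule, and it has full rank.
  let B : Submodule ℤ_[p] (ι → ℤ_[p]) :=
    { θ₀.range with
      smul_mem' := by
        intro c x hx
        have hc : IsClosed {c : ℤ_[p] | c • x ∈ Set.range θ₀} :=
          hcl.preimage (continuous_id.smul continuous_const)
        refine PadicInt.denseRange_intCast.induction_on
          (p := fun c : ℤ_[p] => c • x ∈ Set.range θ₀) c hc fun n => ?_
        rw [Int.cast_smul_eq_zsmul]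
        exact zsmul_mem (K := θ₀.range) hx n }
  have hBmem : ∀ x, e • x ∈ B := by
    intro x
    refine ⟨(g.symm x : W), ?_⟩
    have : φ (g.symm x : W) = e • g.symm x := rfl
    change g (φ _) = _
    rw [this, map_nsmul, g.apply_symm_apply]
  have hfr : Module.finrank ℤ_[p] (ι → ℤ_[p]) = Module.finrank ℤ_[p] B := by
    refine le_antisymm ?_ (Submodule.finrank_le B)
    let E : (ι → ℤ_[p]) →ₗ[ℤ_[p]] B :=
      (e • LinearMap.id : (ι → ℤ_[p]) →ₗ[ℤ_[p]] (ι → ℤ_[p])).codRestrict B hBmem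
    refine LinearMap.finrank_le_finrank_of_injective (f := E) ?_
    rw [injective_iff_map_eq_zero]
    intro x hx
    exact htf x (congrArg Subtype.val hx)
  let L : (ι → ℤ_[p]) ≃ₗ[ℤ_[p]] B := LinearEquiv.ofFinrankEq _ _ hfr
  let T : (ι → ℤ_[p]) →ₗ[ℤ_[p]] (ι → ℤ_[p]) := B.subtype ∘ₗ L.toLinearMap
  have hTc : Continuous T := T.continuous_on_pi
  have hTi : Function.Injective T := B.injective_subtype.comp L.injective
  have hTe := hTc.isClosedEmbedding hTi
  let θ₁ : V →+ B := θ₀.codRestrict B fun x => ⟨x, rfl⟩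
  let θ : V →+ (ι → ℤ_[p]) := (L.symm : B →+ (ι → ℤ_[p])).comp θ₁
  have hTθ : ∀ x, T (θ x) = θ₀ x := fun x => by
    change ((L (L.symm (θ₁ x)) : B) : ι → ℤ_[p]) = _
    rw [L.apply_symm_apply]; rfl
  refine ⟨θ, ?_, ?_, ?_⟩
  · rw [hTe.isEmbedding.isInducing.continuous_iff]
    exact hθc.congr fun x => (hTθ x).symm
  · intro y
    obtain ⟨x, hx⟩ : T y ∈ B := (L y).2
    refine ⟨x, hTi ?_⟩
    rw [hTθ]; exact hx
  · have : θ.ker ≤ θ₀.ker := by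
      intro x hx
      have hx' : θ x = 0 := hx
      change θ₀ x = 0
      rw [← hTθ, hx', map_zero]
    exact Finite.of_injective _ (AddSubgroup.inclusion_injective this)

/-- A continuous surjection with finite kernel from a compact nonarchimedean group onto `ℤ_p^ι`
has a continuous section. A lift `v` of a basis vector need not satisfy `p ^ j • v → 0`, but
`N • v` does, where `N` is the prime-to-`p` part of the order of the kernel; as `N` is a unit of
`ℤ_p`, these multiples serve as well. -/
theorem exists_continuous_section_padicPi {V : Type*} [AddCommGroup V]
    [TopologicalSpace V] [NonarchimedeanAddGroup V] [CompactSpace V] [T2Space V]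
    (θ : V →+ (ι → ℤ_[p])) (hθc : Continuous θ) (hθ : Function.Surjective θ) [Finite θ.ker] :
    ∃ s : (ι → ℤ_[p]) →+ V, Continuous s ∧ ∀ x, θ (s x) = x := by
  classical
  cases nonempty_fintype ι
  obtain ⟨c, N, hN, hcard⟩ := Nat.exists_eq_pow_mul_and_not_dvd (n := Nat.card θ.ker)
    Nat.card_pos.ne' p hp.out.ne_one
  choose v hv using fun i : ι => hθ (Pi.single i 1)
  let _ : UniformSpace V := IsTopologicalAddGroup.rightUniformSpace V
  have : IsUniformAddGroup V := isUniformAddGroup_of_addCommGroup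
  -- Some multiple `p ^ j • N • v i` lies in any given open subgroup.
  have key : ∀ H : OpenAddSubgroup V, ∀ i, ∃ j, p ^ j • N • v i ∈ H := by
    intro H i
    have hS : IsOpen ((θ.ker ⊔ (H : AddSubgroup V) : AddSubgroup V) : Set V) :=
      AddSubgroup.isOpen_mono (le_sup_right (a := θ.ker)) H.isOpen
    have hcl : IsClosed (θ '' ((θ.ker ⊔ (H : AddSubgroup V) : AddSubgroup V) : Set V)ᶜ) :=
      (hS.isClosed_compl.isCompact.image hθc).isClosed
    have h0 : (0 : ι → ℤ_[p]) ∉ θ '' ((θ.ker ⊔ (H : AddSubgroup V) : AddSubgroup V) : Set V)ᶜ := by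
      rintro ⟨x, hx, hx0⟩
      exact hx (le_sup_left (b := (H : AddSubgroup V)) hx0)
    have hnhds := hcl.isOpen_compl.mem_nhds h0
    have hlim : Tendsto (fun j : ℕ => p ^ j • θ (v i)) atTop (𝓝 0) := by
      have h1 : Tendsto (fun j : ℕ => (p : ℤ_[p]) ^ j) atTop (𝓝 0) := by
        refine tendsto_pow_atTop_nhds_zero_of_norm_lt_one ?_
        rw [PadicInt.norm_p]
        exact inv_lt_one_of_one_lt₀ (mod_cast hp.out.one_lt)
      have h2 := h1.smul_const (θ (v i))
      rw [zero_smul] at h2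
      refine h2.congr fun j => ?_
      rw [← Nat.cast_pow, Nat.cast_smul_eq_nsmul]
    obtain ⟨j, hj⟩ := (hlim.eventually hnhds).exists
    have hmem : p ^ j • v i ∈ θ.ker ⊔ (H : AddSubgroup V) := by
      by_contra hno
      exact hj ⟨_, hno, map_nsmul θ _ _⟩
    obtain ⟨f, hf, h, hh, hfh⟩ := AddSubgroup.mem_sup.1 hmem
    refine ⟨c + j, ?_⟩
    have hf0 : (p ^ c * N) • f = 0 := by
      rw [← hcard]
      have := card_nsmul_eq_zero' (x := (⟨f, hf⟩ : θ.ker))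
      exact congrArg Subtype.val this
    have : p ^ (c + j) • N • v i = (p ^ c * N) • h := by
      rw [← zero_add ((p ^ c * N) • h), ← hf0, ← smul_add, hfh]
      simp only [smul_smul]
      congr 1; ring
    rw [this]
    exact H.toAddSubgroup.nsmul_mem hh _
  let f : (ι → ℤ) →+ V :=
    { toFun := fun x => ∑ i, x i • N • v i
      map_zero' := by simp
      map_add' := fun x y => by simp only [Pi.add_apply, add_smul, Finset.sum_add_distrib] }
  obtain ⟨Ψ, hΨc, hΨ⟩ := AddMonoidHom.exists_continuous_extension_of_denseRange
    (intCastPadicPi p ι) denseRange_intCastPadicPi f (by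
      intro U hU
      obtain ⟨H, hH⟩ := NonarchimedeanAddGroup.is_nonarchimedean U hU
      choose j hj using key H
      refine ⟨_, pow_dvd_mem_nhds_zero (Finset.univ.sup j), fun x hx => hH ?_⟩
      refine H.toAddSubgroup.sum_mem fun i _ => ?_
      have h1 : (p : ℤ) ^ j i ∣ x i := (pow_dvd_pow _ (Finset.le_sup (Finset.mem_univ i))).trans
        (PadicInt.pow_dvd_intCast.1 (hx i))
      obtain ⟨y, hy⟩ := h1
      have h2 : x i • N • v i = y • p ^ j i • N • v i := by
        rw [hy, mul_comm, mul_smul]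
        congr 1
        rw [← Nat.cast_pow, natCast_zsmul]
      rw [h2]
      exact H.toAddSubgroup.zsmul_mem (hj i) y)
  have hθΨ : ∀ x, θ (Ψ x) = N • x := by
    intro x
    refine denseRange_intCastPadicPi.induction_on (p := fun x => θ (Ψ x) = N • x) x
      (isClosed_eq (hθc.comp hΨc) (continuous_const_smul N)) fun x => ?_
    rw [hΨ]
    change θ (∑ i, x i • N • v i) = _
    rw [map_sum]
    ext k
    simp only [map_zsmul, map_nsmul, hv, Finset.sum_apply, Pi.smul_apply]
    rw [Finset.sum_eq_single k (fun i _ hi => by simp [Pi.single_eq_of_ne' hi]) (by simp)]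
    simp [intCastPadicPi, mul_comm]
  have hNu : IsUnit (N : ℤ_[p]) := by
    rw [PadicInt.isUnit_iff, PadicInt.norm_natCast_eq_one_iff]
    exact ((Nat.Prime.coprime_iff_not_dvd hp.out).2 hN)
  obtain ⟨u, hu⟩ := hNu
  refine ⟨Ψ.comp (DistribSMul.toAddMonoidHom (ι → ℤ_[p]) (↑u⁻¹ : ℤ_[p])),
    hΨc.comp (continuous_const_smul _), fun x => ?_⟩
  simp only [AddMonoidHom.comp_apply, DistribSMul.toAddMonoidHom_apply, hθΨ]
  rw [← Nat.cast_smul_eq_nsmul ℤ_[p], ← hu, smul_smul, Units.mul_inv, one_smul]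

/-- A compact nonarchimedean group with an open subgroup `ℤ_p^ι` is the product of `ℤ_p^ι` and a
finite group. The finite group may have `p`-torsion. -/
theorem nonempty_continuousAddEquiv_prod_finite {V : Type*} [AddCommGroup V]
    [TopologicalSpace V] [NonarchimedeanAddGroup V] [CompactSpace V] [T2Space V]
    (W : AddSubgroup V) (hW : IsOpen (W : Set V)) (g : W ≃ₜ+ (ι → ℤ_[p])) :
    ∃ F : AddSubgroup V, Finite F ∧ Nonempty (V ≃ₜ+ (ι → ℤ_[p]) × F) := by
  obtain ⟨θ, hθc, hθ, hfin⟩ := exists_surjective_padicPi_of_open_addSubgroup W hW g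
  obtain ⟨s, hsc, hs⟩ := exists_continuous_section_padicPi θ hθc hθ
  let r : V →+ θ.ker := (AddMonoidHom.id V - s.comp θ).codRestrict θ.ker fun x => by
    change θ (x - s (θ x)) = 0
    rw [map_sub, hs, sub_self]
  have hr : ∀ x, (r x : V) = x - s (θ x) := fun x => rfl
  have hrc : Continuous r :=
    Continuous.subtype_mk (f := fun x => x - s (θ x)) (continuous_id.sub (hsc.comp hθc)) _
  refine ⟨θ.ker, hfin, ⟨
    { toFun := fun x => (θ x, r x)
      invFun := fun y => s y.1 + y.2
      left_inv := fun x => by simp [hr]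
      right_inv := fun y => by
        have h2 : θ (y.2 : V) = 0 := y.2.2
        ext1
        · simp [hs, h2]
        · ext1
          simp [hr, hs, h2]
      map_add' := fun x y => by simp
      continuous_toFun := hθc.prodMk hrc
      continuous_invFun :=
        (hsc.comp continuous_fst).add (continuous_subtype_val.comp continuous_snd) }⟩⟩

end Splitting

end

/-! ### Unit groups of p-adic orders -/

section

open Filter Topology

/-- The topological ring `R` is a `ℤ_p`-order with `ℤ_p`-basis `b`: its topology is the `p`-adic
one, it has no `p`-torsion, the family `b` is a basis of `R / p R` over `𝔽_p`, and `p` lies in the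
Jacobson radical. No `ℤ_p`-module structure is mentioned. -/
structure IsPadicOrder (p : ℕ) {ι : Type*} [Fintype ι] {R : Type*} [CommRing R]
    [TopologicalSpace R] (b : ι → R) : Prop where
  mem_nhds : ∀ m : ℕ, {r : R | (p : R) ^ m ∣ r} ∈ 𝓝 (0 : R)
  basis : ∀ U ∈ 𝓝 (0 : R), ∃ m : ℕ, {r : R | (p : R) ^ m ∣ r} ⊆ U
  eq_zero_of_mul : ∀ r : R, (p : R) * r = 0 → r = 0
  span : ∀ r : R, ∃ x : ι → ℤ, (p : R) ∣ r - ∑ i, x i • b i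
  indep : ∀ x : ι → ℤ, (p : R) ∣ ∑ i, x i • b i → ∀ i, (p : ℤ) ∣ x i
  isUnit_one_add : ∀ r : R, IsUnit (1 + (p : R) * r)

namespace IsPadicOrder

variable {p : ℕ} {ι : Type*} [Fintype ι] {R : Type*} [CommRing R]

theorem dvd_of_pow_mul_dvd [TopologicalSpace R] {b : ι → R} (h : IsPadicOrder p b) {m n : ℕ} {r : R}
    (hr : (p : R) ^ (m + n) ∣ (p : R) ^ m * r) : (p : R) ^ n ∣ r := by
  induction m with
  | zero => simpa using hr
  | succ m ih =>
    refine ih ?_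
    obtain ⟨s, hs⟩ := hr
    refine ⟨s, ?_⟩
    rw [← sub_eq_zero]
    refine h.eq_zero_of_mul _ ?_
    rw [← sub_eq_zero] at hs
    rw [← hs]; ring

theorem intCast_dvd [Nonempty ι] [hp : Fact p.Prime] [TopologicalSpace R] {b : ι → R}
    (h : IsPadicOrder p b) {n : ℤ} (hn : (p : R) ∣ (n : R)) : (p : ℤ) ∣ n := by
  classical
  by_contra hno
  have hco : IsCoprime (p : ℤ) n :=
    (Nat.prime_iff_prime_int.1 hp.out).irreducible.coprime_iff_not_dvd.2 hno
  obtain ⟨a, c, hac⟩ := hco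
  have h1 : (p : R) ∣ 1 := by
    have : (1 : R) = (a : R) * p + c * n := by exact_mod_cast congrArg (Int.cast : ℤ → R) hac.symm
    rw [this]
    exact dvd_add (Dvd.intro_left _ rfl) (hn.mul_left _)
  obtain ⟨i⟩ := ‹Nonempty ι›
  have h2 := h.indep (Pi.single i 1) (h1.trans (one_dvd _)) i
  rw [Pi.single_eq_same] at h2
  exact (Nat.prime_iff_prime_int.1 hp.out).not_dvd_one h2

/-- A `ℤ_p`-order is additively `ℤ_p^ι`, as a topological group. -/
theorem nonempty_continuousAddEquiv [Fact p.Prime] [UniformSpace R] [IsUniformAddGroup R]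
    [CompleteSpace R] [T2Space R] {b : ι → R} (h : IsPadicOrder p b) :
    Nonempty ((ι → ℤ_[p]) ≃ₜ+ R) := by
  have hmem : ∀ (m : ℕ) (w : R), w ∈ (Ideal.span {(p : R) ^ m}).toAddSubgroup ↔ (p : R) ^ m ∣ w :=
    fun m w => Ideal.mem_span_singleton
  refine nonempty_continuousAddEquiv_padicPi
    (fun m => (Ideal.span {(p : R) ^ m}).toAddSubgroup) b ?_ ?_ ?_ ?_ ?_
  · simp
  · intro U hU
    obtain ⟨m, hm⟩ := h.basis U hU
    exact ⟨m, fun x hx => hm ((hmem m x).1 hx)⟩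
  · intro m w hw
    rw [hmem] at hw ⊢
    rw [nsmul_eq_mul, pow_succ']
    exact mul_dvd_mul_left _ hw
  · intro m w hw
    rw [hmem] at hw
    obtain ⟨r, rfl⟩ := hw
    obtain ⟨x, hx⟩ := h.span r
    refine ⟨x, ?_⟩
    rw [hmem, nsmul_eq_mul, Nat.cast_pow, ← mul_sub, pow_succ]
    exact mul_dvd_mul_left _ hx
  · intro m x hx
    rw [hmem, nsmul_eq_mul, Nat.cast_pow] at hx
    refine h.indep x ?_
    have := h.dvd_of_pow_mul_dvd hx
    rwa [pow_one] at this

end IsPadicOrder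

/-- The additive form of the subgroup of units congruent to `1` modulo `p ^ m`. -/
def principalUnits (p : ℕ) (R : Type*) [CommRing R] (m : ℕ) : AddSubgroup (Additive Rˣ) where
  carrier := {u | (p : R) ^ m ∣ (u.toMul : R) - 1}
  zero_mem' := by simp
  add_mem' {u v} hu hv := by
    have : ((u + v).toMul : R) - 1 = (u.toMul : R) * ((v.toMul : R) - 1) + ((u.toMul : R) - 1) := by
      rw [toMul_add, Units.val_mul]; ring
    rw [Set.mem_ofPred_eq, this]
    exact dvd_add (Dvd.dvd.mul_left hv _) hu
  neg_mem' {u} hu := by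
    have : ((-u).toMul : R) - 1 = -((-u).toMul : R) * ((u.toMul : R) - 1) := by
      rw [toMul_neg, mul_sub, neg_mul, Units.inv_mul]; ring
    rw [Set.mem_ofPred_eq, this]
    exact Dvd.dvd.mul_left hu _

theorem mem_principalUnits {p : ℕ} {R : Type*} [CommRing R] {m : ℕ} {u : Additive Rˣ} :
    u ∈ principalUnits p R m ↔ (p : R) ^ m ∣ (u.toMul : R) - 1 := Iff.rfl

theorem exists_one_add_pow_eq {R : Type*} [CommRing R] (y : R) (n : ℕ) :
    ∃ z, (1 + y) ^ n = 1 + n * y + y ^ 2 * z := by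
  induction n with
  | zero => exact ⟨0, by simp⟩
  | succ n ih =>
    obtain ⟨z, hz⟩ := ih
    refine ⟨z + n + y * z, ?_⟩
    rw [pow_succ, hz]; push_cast; ring

/-- The unit `u` has leading term `r` in degree `m`: `u ≡ 1 + p ^ m * r` modulo `p ^ (m + 1)`. -/
def HasLeadingTerm (p : ℕ) {R : Type*} [CommRing R] (m : ℕ) (u : Additive Rˣ) (r : R) : Prop :=
  (p : R) ^ (m + 1) ∣ (u.toMul : R) - 1 - (p : R) ^ m * r

namespace HasLeadingTerm

variable {p : ℕ} {R : Type*} [CommRing R] {m : ℕ} {u v : Additive Rˣ} {r s : R}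

theorem mem (h : HasLeadingTerm p m u r) : u ∈ principalUnits p R m := by
  rw [mem_principalUnits, ← sub_add_cancel ((u.toMul : R) - 1) ((p : R) ^ m * r)]
  exact dvd_add ((pow_dvd_pow _ m.le_succ).trans h) (dvd_mul_right _ _)

theorem zero : HasLeadingTerm p m (0 : Additive Rˣ) (0 : R) := by
  simp [HasLeadingTerm]

theorem add (hm : 1 ≤ m) (hu : HasLeadingTerm p m u r) (hv : HasLeadingTerm p m v s) :
    HasLeadingTerm p m (u + v) (r + s) := by
  have h1 := hu.mem
  rw [mem_principalUnits] at h1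
  have h2 := hv.mem
  rw [mem_principalUnits] at h2
  have h3 : (p : R) ^ (m + 1) ∣ ((u.toMul : R) - 1) * ((v.toMul : R) - 1) := by
    refine (pow_dvd_pow _ (by omega : m + 1 ≤ m + m)).trans ?_
    rw [pow_add]
    exact mul_dvd_mul h1 h2
  have := dvd_add h3 (dvd_add hu hv)
  unfold HasLeadingTerm
  convert this using 1
  rw [toMul_add, Units.val_mul]; ring

theorem neg (hm : 1 ≤ m) (hu : HasLeadingTerm p m u r) : HasLeadingTerm p m (-u) (-r) := by
  have h1 := hu.mem
  rw [mem_principalUnits] at h1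
  have h2 := (principalUnits p R m).neg_mem hu.mem
  rw [mem_principalUnits] at h2
  have h3 : (p : R) ^ (m + 1) ∣ ((u.toMul : R) - 1) * (((-u).toMul : R) - 1) := by
    refine (pow_dvd_pow _ (by omega : m + 1 ≤ m + m)).trans ?_
    rw [pow_add]
    exact mul_dvd_mul h1 h2
  have := dvd_sub (dvd_neg.2 hu) h3
  unfold HasLeadingTerm
  convert this using 1
  have h4 : (u.toMul : R) * ((-u).toMul : R) = 1 := by rw [toMul_neg, Units.mul_inv]
  linear_combination h4

theorem zsmul (hm : 1 ≤ m) (hu : HasLeadingTerm p m u r) (n : ℤ) :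
    HasLeadingTerm p m (n • u) (n • r) := by
  have hnat : ∀ n : ℕ, HasLeadingTerm p m (n • u) (n • r) := by
    intro n
    induction n with
    | zero => simpa using zero
    | succ n ih => rw [succ_nsmul, succ_nsmul]; exact ih.add hm hu
  obtain ⟨n, rfl | rfl⟩ := n.eq_nat_or_neg
  · simpa using hnat n
  · rw [neg_smul, neg_smul, natCast_zsmul, natCast_zsmul]
    exact (hnat n).neg hm

theorem sum {ι : Type*} (t : Finset ι) (hm : 1 ≤ m) (w : ι → Additive Rˣ) (c : ι → R)
    (h : ∀ i, HasLeadingTerm p m (w i) (c i)) :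
    HasLeadingTerm p m (∑ i ∈ t, w i) (∑ i ∈ t, c i) := by
  classical
  induction t using Finset.induction_on with
  | empty => simpa using zero
  | insert a t ha ih => rw [Finset.sum_insert ha, Finset.sum_insert ha]; exact (h a).add hm ih

/-- Raising to the power `p` preserves the leading term and raises the degree by one. In degree one
this fails for `p = 2`. -/
theorem nsmul_p (hm : 2 ≤ m) (hu : HasLeadingTerm p m u r) :
    HasLeadingTerm p (m + 1) (p • u) r := by
  obtain ⟨s, hs⟩ := hu
  obtain ⟨z, hz⟩ := exists_one_add_pow_eq ((u.toMul : R) - 1) p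
  have h1 : ((p • u).toMul : R) = (u.toMul : R) ^ p := by simp
  obtain ⟨k, rfl⟩ := Nat.exists_eq_add_of_le hm
  have h2 : (u.toMul : R) - 1 = (p : R) ^ (2 + k) * r + (p : R) ^ (2 + k + 1) * s := by
    rw [← hs]; ring
  refine ⟨s + (p : R) ^ k * (r + p * s) ^ 2 * z, ?_⟩
  rw [h1, ← add_sub_cancel 1 (u.toMul : R), hz, h2]
  ring

theorem nsmul_pow (hm : 2 ≤ m) (hu : HasLeadingTerm p m u r) (k : ℕ) :
    HasLeadingTerm p (m + k) (p ^ k • u) r := by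
  induction k with
  | zero => simpa using hu
  | succ k ih =>
    rw [pow_succ', mul_smul, ← add_assoc]
    exact ih.nsmul_p (by omega)

theorem mem_succ (hu : HasLeadingTerm p m u r) (hr : (p : R) ∣ r) :
    u ∈ principalUnits p R (m + 1) := by
  rw [mem_principalUnits, ← sub_add_cancel ((u.toMul : R) - 1) ((p : R) ^ m * r)]
  refine dvd_add hu ?_
  rw [pow_succ]
  exact mul_dvd_mul_left _ hr

theorem dvd_of_mem_succ {ι : Type*} [Fintype ι] [TopologicalSpace R] {b : ι → R}
    (h : IsPadicOrder p b)
    (hu : HasLeadingTerm p m u r) (hmem : u ∈ principalUnits p R (m + 1)) : (p : R) ∣ r := by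
  rw [mem_principalUnits] at hmem
  have h1 : (p : R) ^ (m + 1) ∣ (p : R) ^ m * r := by
    have := dvd_sub hmem hu
    rwa [sub_sub_cancel] at this
  have := h.dvd_of_pow_mul_dvd h1
  rwa [pow_one] at this

theorem exists_of_mem (hu : u ∈ principalUnits p R m) : ∃ r, HasLeadingTerm p m u r := by
  obtain ⟨r, hr⟩ := mem_principalUnits.1 hu
  exact ⟨r, by simp [HasLeadingTerm, hr]⟩

end HasLeadingTerm

namespace IsPadicOrder

variable {p : ℕ} {ι : Type*} [Fintype ι] {R : Type*} [CommRing R] [TopologicalSpace R]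
  [IsTopologicalRing R] {b : ι → R}

theorem principalUnits_mem_nhds (h : IsPadicOrder p b) (m : ℕ) :
    (principalUnits p R m : Set (Additive Rˣ)) ∈ 𝓝 (0 : Additive Rˣ) := by
  have hc : Continuous fun u : Additive Rˣ => (u.toMul : R) - 1 :=
    (Units.continuous_val.comp continuous_toMul).sub continuous_const
  have := hc.tendsto 0
  simp only [toMul_zero, Units.val_one, sub_self] at this
  exact this (h.mem_nhds m)

theorem exists_principalUnits_subset (h : IsPadicOrder p b) (U : Set (Additive Rˣ))
    (hU : U ∈ 𝓝 (0 : Additive Rˣ)) :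
    ∃ m, (principalUnits p R m : Set (Additive Rˣ)) ⊆ U := by
  have hU' : Additive.ofMul ⁻¹' U ∈ 𝓝 (1 : Rˣ) := continuous_ofMul.continuousAt hU
  rw [Units.isInducing_embedProduct.nhds_eq_comap] at hU'
  obtain ⟨S, hS, hSU⟩ := hU'
  rw [map_one, Prod.one_eq_mk, nhds_prod_eq] at hS
  -- The topology of `Rˣ` is induced by `u ↦ (u, u⁻¹)`, and both components are `p`-adically close
  -- to `1`.
  obtain ⟨S₁, hS₁, S₂, hS₂, hSS⟩ := mem_prod_iff.1 hS
  have e1 : ∀ T ∈ 𝓝 (1 : R), ∃ m, ∀ y, (p : R) ^ m ∣ y - 1 → y ∈ T := by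
    intro T hT
    have hT' : (fun z : R => z + 1) ⁻¹' T ∈ 𝓝 (0 : R) := by
      refine (continuous_id.add continuous_const).continuousAt ?_
      simpa using hT
    obtain ⟨m, hm⟩ := h.basis _ hT'
    refine ⟨m, fun y hy => ?_⟩
    have := hm hy
    rwa [Set.mem_preimage, sub_add_cancel] at this
  obtain ⟨m₁, hm₁⟩ := e1 S₁ hS₁
  obtain ⟨m₂, hm₂⟩ := e1 (MulOpposite.op ⁻¹' S₂) (MulOpposite.continuous_op.continuousAt hS₂)
  refine ⟨max m₁ m₂, fun u hu => ?_⟩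
  have hu' := (principalUnits p R (max m₁ m₂)).neg_mem hu
  refine hSU (a := u.toMul) (hSS ⟨?_, ?_⟩)
  · exact hm₁ _ ((pow_dvd_pow _ (le_max_left _ _)).trans hu)
  · exact hm₂ _ ((pow_dvd_pow _ (le_max_right _ _)).trans hu')

theorem isOpen_principalUnits (h : IsPadicOrder p b) (m : ℕ) :
    IsOpen (principalUnits p R m : Set (Additive Rˣ)) :=
  AddSubgroup.isOpen_of_mem_nhds _ (h.principalUnits_mem_nhds m)

theorem nonarchimedeanAddGroup_units (h : IsPadicOrder p b) :
    NonarchimedeanAddGroup (Additive Rˣ) where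
  is_nonarchimedean U hU := by
    obtain ⟨m, hm⟩ := h.exists_principalUnits_subset U hU
    exact ⟨⟨principalUnits p R m, h.isOpen_principalUnits m⟩, hm⟩

theorem _root_.t2Space_additive_units {R : Type*} [Monoid R] [TopologicalSpace R] [T2Space R] :
    T2Space (Additive Rˣ) :=
  have : T2Space Rˣ := Units.isEmbedding_embedProduct.t2Space
  inferInstanceAs (T2Space Rˣ)

/-- The units congruent to `1` modulo `p ^ 2` form a group isomorphic to `ℤ_p^ι`. -/
theorem nonempty_principalUnits_equiv [Fact p.Prime] [CompactSpace R] [T2Space R]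
    (h : IsPadicOrder p b) :
    Nonempty (principalUnits p R 2 ≃ₜ+ (ι → ℤ_[p])) := by
  have := t2Space_additive_units (R := R)
  have hclosed : IsClosed (principalUnits p R 2 : Set (Additive Rˣ)) :=
    AddSubgroup.isClosed_of_isOpen _ (h.isOpen_principalUnits 2)
  have : CompactSpace (principalUnits p R 2) := isCompact_iff_compactSpace.1 hclosed.isCompact
  let _ : UniformSpace (principalUnits p R 2) := IsTopologicalAddGroup.rightUniformSpace _
  have : IsUniformAddGroup (principalUnits p R 2) := isUniformAddGroup_of_addCommGroup
  have hunit : ∀ i, IsUnit (1 + (p : R) * (p * b i)) := fun i => h.isUnit_one_add _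
  choose c hc using hunit
  have hlead : ∀ i, HasLeadingTerm p 2 (Additive.ofMul (c i)) (b i) := fun i => by
    unfold HasLeadingTerm
    rw [toMul_ofMul, hc, show 1 + (p : R) * (p * b i) - 1 - (p : R) ^ 2 * b i = 0 by ring]
    exact dvd_zero _
  let b' : ι → principalUnits p R 2 := fun i => ⟨Additive.ofMul (c i), (hlead i).mem⟩
  have hsum : ∀ (m : ℕ) (x : ι → ℤ), HasLeadingTerm p (2 + m)
      ((p ^ m • ∑ i, x i • b' i : principalUnits p R 2) : Additive Rˣ) (∑ i, x i • b i) := by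
    intro m x
    have h1 := (HasLeadingTerm.sum Finset.univ one_le_two _ _
      fun i => (hlead i).zsmul one_le_two (x i)).nsmul_pow le_rfl m
    convert h1 using 1
    simp [b']
  refine Nonempty.map ContinuousAddEquiv.symm <| nonempty_continuousAddEquiv_padicPi (p := p)
    (fun m => (principalUnits p R (2 + m)).addSubgroupOf (principalUnits p R 2)) b' (by simp)
    (fun U hU => ?_) (fun m w hw => ?_) (fun m w hw => ?_) (fun m x hx => ?_)
  · obtain ⟨U', hU', hUU⟩ := (mem_nhds_subtype _ _ _).1 hU
    obtain ⟨m, hm⟩ := h.exists_principalUnits_subset U' hU'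
    refine ⟨m, fun x hx => hUU (hm ?_)⟩
    rw [SetLike.mem_coe, AddSubgroup.mem_addSubgroupOf, mem_principalUnits] at hx
    exact (pow_dvd_pow _ (by omega)).trans hx
  · rw [AddSubgroup.mem_addSubgroupOf] at hw ⊢
    obtain ⟨r, hr⟩ := HasLeadingTerm.exists_of_mem hw
    exact (hr.nsmul_p (by omega)).mem
  · rw [AddSubgroup.mem_addSubgroupOf] at hw
    obtain ⟨r, hr⟩ := HasLeadingTerm.exists_of_mem hw
    obtain ⟨x, hx⟩ := h.span r
    refine ⟨x, ?_⟩
    rw [AddSubgroup.mem_addSubgroupOf, AddSubgroup.coe_sub, sub_eq_add_neg]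
    rw [sub_eq_add_neg] at hx
    exact (hr.add (by omega) ((hsum m x).neg (by omega))).mem_succ hx
  · rw [AddSubgroup.mem_addSubgroupOf] at hx
    exact h.indep x ((hsum m x).dvd_of_mem_succ h hx)

/-- The unit group of a `ℤ_p`-order of rank `n` is the product of `ℤ_p^n` and a finite group. -/
theorem nonempty_units_equiv [Fact p.Prime] [CompactSpace R] [T2Space R] (h : IsPadicOrder p b) :
    ∃ F : AddSubgroup (Additive Rˣ), Finite F ∧
      Nonempty (Additive Rˣ ≃ₜ+ (ι → ℤ_[p]) × F) := by
  have := h.nonarchimedeanAddGroup_units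
  have := t2Space_additive_units (R := R)
  obtain ⟨g⟩ := h.nonempty_principalUnits_equiv
  exact nonempty_continuousAddEquiv_prod_finite _ (h.isOpen_principalUnits 2) g

end IsPadicOrder

end

/-! ### Cyclic factors of prime power order in the unit group -/

section

open Filter Topology

/-- A finite product of cyclic groups of prime power order, whose `ℓ`-primary torsion is killed by
`ℓ ^ (k + 1)` but not by `ℓ ^ k`, has a factor of order `ℓ ^ (k + 1)`. -/
theorem exists_primePow_eq_of_exponent {J : Type*} (q a : J → ℕ) (hq : ∀ j, (q j).Prime)
    {ℓ k : ℕ} (hℓ : ℓ.Prime)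
    (hA : ∀ f : ∀ j, ZMod (q j ^ a j), ∀ i : ℕ, ℓ ^ i • f = 0 → ℓ ^ (k + 1) • f = 0)
    (hB : ∃ f : ∀ j, ZMod (q j ^ a j), ℓ ^ (k + 1) • f = 0 ∧ ℓ ^ k • f ≠ 0) :
    ∃ j, q j ^ a j = ℓ ^ (k + 1) := by
  classical
  by_contra! hno
  obtain ⟨f, hf, hf'⟩ := hB
  refine hf' (funext fun j => ?_)
  have hfj : ℓ ^ (k + 1) • f j = 0 := congrFun hf j
  rw [Pi.smul_apply, Pi.zero_apply]
  by_cases hj : q j = ℓ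
  · have h1 : ∀ i, (ℓ ^ i • (Pi.single j (1 : ZMod (q j ^ a j)) : ∀ j, ZMod (q j ^ a j)) = 0) ↔
        a j ≤ i := by
      intro i
      rw [← Pi.single_smul (f := fun j => ZMod (q j ^ a j)), Pi.single_eq_zero_iff,
        nsmul_eq_mul, mul_one, ZMod.natCast_eq_zero_iff, hj]
      exact Nat.pow_dvd_pow_iff_le_right hℓ.one_lt
    have h2 : a j ≤ k + 1 := (h1 _).1 (hA _ (a j) ((h1 _).2 le_rfl))
    have h3 : a j ≠ k + 1 := fun h => hno j (by rw [hj, h])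
    have h4 : q j ^ a j ∣ ℓ ^ k := by
      rw [hj]; exact pow_dvd_pow _ (by omega)
    rw [nsmul_eq_mul, (ZMod.natCast_eq_zero_iff _ _).2 h4, zero_mul]
  · have hco : Nat.Coprime (ℓ ^ (k + 1)) (q j ^ a j) :=
      Nat.Coprime.pow _ _ ((Nat.coprime_primes hℓ (hq j)).2 (Ne.symm hj))
    have hu := (ZMod.isUnit_iff_coprime (ℓ ^ (k + 1)) (q j ^ a j)).2 hco
    rw [nsmul_eq_mul] at hfj
    rw [(hu.mul_right_eq_zero).1 hfj, smul_zero]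

namespace IsPadicOrder

variable {p : ℕ} {ι : Type*} [Fintype ι] {R : Type*} [CommRing R]
  [TopologicalSpace R] [IsTopologicalRing R] {b : ι → R}

/-- There is no prime-to-`p` torsion among the units congruent to `1` modulo `p`. -/
theorem eq_zero_of_mem_principalUnits_of_nsmul [T2Space R] (h : IsPadicOrder p b)
    {u : Additive Rˣ} (hu : u ∈ principalUnits p R 1) {n : ℕ} (hn : n.Coprime p)
    (hnu : n • u = 0) : u = 0 := by
  have := t2Space_additive_units (R := R)
  have key : ∀ m, u ∈ principalUnits p R (m + 1) := by
    intro m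
    induction m with
    | zero => exact hu
    | succ m ih =>
      obtain ⟨r, hr⟩ := HasLeadingTerm.exists_of_mem ih
      have h1 := hr.zsmul (by omega) n
      rw [natCast_zsmul, natCast_zsmul, hnu] at h1
      have h2 : (p : R) ∣ n • r := h1.dvd_of_mem_succ h (zero_mem _)
      refine hr.mem_succ ?_
      have h3 : IsCoprime (p : R) (n : R) := by
        have := (Nat.isCoprime_iff_coprime.2 hn.symm).map (Int.castRingHom R)
        simpa using this
      rw [nsmul_eq_mul] at h2
      exact h3.dvd_of_dvd_mul_left h2
  by_contra hne
  obtain ⟨m, hm⟩ := h.exists_principalUnits_subset {u}ᶜ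
    (isOpen_compl_singleton.mem_nhds (Ne.symm hne))
  refine hm (a := u) ?_ rfl
  exact (pow_dvd_pow _ m.le_succ).trans (key m)

/-- If every unit of `R` has order dividing `p - 1` modulo `p`, then the `ℓ`-primary torsion of the
units is killed by the exact power of `ℓ` dividing `p - 1`, and this is optimal because of a
primitive root modulo `p`. Hence a cyclic group of that order occurs as a factor of the torsion
subgroup. -/
theorem exists_primePow_eq [hp : Fact p.Prime] [Nonempty ι] [T2Space R]
    (h : IsPadicOrder p b) (hsplit : ∀ u : Rˣ, (p : R) ∣ (u : R) ^ (p - 1) - 1)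
    {F : Type*} [AddCommGroup F] [Finite F] [TopologicalSpace F]
    (e : Additive Rˣ ≃ₜ+ (ι → ℤ_[p]) × F) {J : Type*} (q a : J → ℕ) (hq : ∀ j, (q j).Prime)
    (d : F ≃+ (∀ j, ZMod (q j ^ a j))) {ℓ k : ℕ} (hℓ : ℓ.Prime) (hℓp : ℓ ≠ p)
    (hdvd : ℓ ^ (k + 1) ∣ p - 1) (hndvd : ¬ ℓ ^ (k + 2) ∣ p - 1) :
    ∃ j, q j ^ a j = ℓ ^ (k + 1) := by
  have hcop : ∀ i, (ℓ ^ i).Coprime p := fun i =>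
    Nat.Coprime.pow_left _ ((Nat.coprime_primes hℓ hp.out).2 hℓp)
  have hmem1 : ∀ u : Additive Rˣ, (p - 1) • u ∈ principalUnits p R 1 := fun u => by
    rw [mem_principalUnits, pow_one]
    simpa using hsplit u.toMul
  have hA : ∀ f : F, ∀ i : ℕ, ℓ ^ i • f = 0 → ℓ ^ (k + 1) • f = 0 := by
    intro f i hf
    have h1 : ℓ ^ i • e.symm (0, f) = 0 := by
      rw [← map_nsmul, Prod.smul_mk, hf, smul_zero, Prod.mk_zero_zero, map_zero]
    have h2 : (p - 1) • e.symm (0, f) = 0 :=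
      h.eq_zero_of_mem_principalUnits_of_nsmul (hmem1 _) (hcop i) (by
        rw [smul_comm, h1, smul_zero])
    have h3 : (p - 1) • f = 0 := by
      rw [← map_nsmul, Prod.smul_mk] at h2
      have := (e.symm.injective (h2.trans (map_zero e.symm).symm))
      exact congrArg Prod.snd this
    obtain ⟨j, -, hj⟩ := (Nat.dvd_prime_pow hℓ).1 (addOrderOf_dvd_of_nsmul_eq_zero hf)
    have h4 : ℓ ^ j ∣ p - 1 := hj ▸ addOrderOf_dvd_of_nsmul_eq_zero h3
    refine addOrderOf_dvd_iff_nsmul_eq_zero.1 ?_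
    rw [hj]
    refine pow_dvd_pow _ ?_
    by_contra hlt
    exact hndvd ((pow_dvd_pow _ (by omega)).trans h4)
  have hB : ∃ f : F, ℓ ^ (k + 1) • f = 0 ∧ ℓ ^ k • f ≠ 0 := by
    -- Otherwise `ℓ ^ k` kills the `ℓ`-primary part of `F`.
    by_contra! hno
    have hpdvd : ∀ n : ℤ, (p : R) ∣ (n : R) → (p : ℤ) ∣ n := fun n => h.intCast_dvd
    obtain ⟨g, hg⟩ := IsCyclic.exists_generator (α := (ZMod p)ˣ)
    have hgord : orderOf g = p - 1 := by
      rw [orderOf_eq_card_of_forall_mem_zpowers hg, Nat.card_eq_fintype_card, ZMod.card_units]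
    set n : ℕ := (g : ZMod p).val with hn
    have hng : (n : ZMod p) = g := ZMod.natCast_zmod_val _
    have hdvd_pow : ∀ t : ℕ, (p : ℤ) ∣ (n : ℤ) ^ t - 1 ↔ p - 1 ∣ t := by
      intro t
      rw [← hgord, orderOf_dvd_iff_pow_eq_one, ← ZMod.intCast_zmod_eq_zero_iff_dvd, ← Units.val_inj]
      push_cast
      rw [hng, sub_eq_zero]
    -- The primitive root `n` is a unit of `R`, because `n ^ (p - 1) ∈ 1 + p R`.
    have hnu : IsUnit (n : R) := by
      obtain ⟨c, hc⟩ := (hdvd_pow (p - 1)).2 dvd_rfl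
      have h1 : (n : R) ^ (p - 1) = 1 + (p : R) * (c : R) := by
        have := congrArg (Int.cast : ℤ → R) hc
        push_cast at this
        rw [← this]; ring
      have h2 : IsUnit ((n : R) ^ (p - 1)) := h1 ▸ h.isUnit_one_add _
      exact (isUnit_pow_iff (Nat.sub_ne_zero_of_lt hp.out.one_lt)).1 h2
    obtain ⟨u, hu⟩ := hnu
    have hu_mem : ∀ t : ℕ, t • Additive.ofMul u ∈ principalUnits p R 1 → p - 1 ∣ t := by
      intro t ht
      rw [mem_principalUnits, pow_one] at ht
      refine (hdvd_pow t).1 (hpdvd _ ?_)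
      push_cast
      rw [← hu]
      exact ht
    obtain ⟨c, M, hM, hcard⟩ := Nat.exists_eq_pow_mul_and_not_dvd (n := Nat.card F)
      Nat.card_pos.ne' ℓ hℓ.ne_one
    have hsec : (ℓ ^ k * M) • (e (Additive.ofMul u)).2 = 0 := by
      rw [mul_smul]
      refine hno _ (hA _ c ?_)
      rw [smul_smul, ← hcard]
      exact card_nsmul_eq_zero'
    -- As `ℓ ^ k * M` kills the torsion component of `u`, multiplying further by powers of `p`
    -- brings `u` close to `1`. So `p - 1` divides some `p ^ j * (ℓ ^ k * M)`, which is
    -- impossible at `ℓ`.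
    have hlim : Tendsto (fun j : ℕ => (p ^ j * (ℓ ^ k * M)) • Additive.ofMul u) atTop (𝓝 0) := by
      have h1 : Tendsto (fun j : ℕ => (p : ℤ_[p]) ^ j) atTop (𝓝 0) := by
        refine tendsto_pow_atTop_nhds_zero_of_norm_lt_one ?_
        rw [PadicInt.norm_p]
        exact inv_lt_one_of_one_lt₀ (mod_cast hp.out.one_lt)
      have h2 := h1.smul_const ((ℓ ^ k * M) • (e (Additive.ofMul u)).1)
      rw [zero_smul] at h2
      have h3 := (h2.prodMk_nhds (tendsto_const_nhds (x := (0 : F))))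
      have hc : Continuous fun y => e.symm y := e.symm.continuous
      have h4 := (hc.tendsto (0, 0)).comp h3
      rw [Prod.mk_zero_zero, map_zero] at h4
      refine h4.congr fun j => ?_
      rw [Function.comp_apply, e.symm_apply_eq, map_nsmul]
      ext1
      · change _ = (p ^ j * (ℓ ^ k * M)) • (e (Additive.ofMul u)).1
        rw [← Nat.cast_pow, Nat.cast_smul_eq_nsmul, smul_smul]
      · change _ = (p ^ j * (ℓ ^ k * M)) • (e (Additive.ofMul u)).2
        rw [mul_smul (p ^ j) (ℓ ^ k * M) (e (Additive.ofMul u)).2, hsec, smul_zero]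
    obtain ⟨j, hj⟩ := (hlim.eventually (h.principalUnits_mem_nhds 1)).exists
    have h5 : ℓ ^ (k + 1) ∣ p ^ j * (ℓ ^ k * M) := hdvd.trans (hu_mem _ hj)
    have h6 : ℓ ^ (k + 1) ∣ ℓ ^ k * M := ((hcop _).pow_right j).dvd_of_dvd_mul_left h5
    rw [pow_succ] at h6
    exact hM (Nat.dvd_of_mul_dvd_mul_left (pow_pos hℓ.pos k) h6)
  refine exists_primePow_eq_of_exponent q a hq hℓ (k := k) (fun f i hf => ?_) ?_
  · have := hA (d.symm f) i (by rw [← map_nsmul, hf, map_zero])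
    rw [← map_nsmul] at this
    exact d.symm.injective (this.trans (map_zero _).symm)
  · obtain ⟨f, hf, hf'⟩ := hB
    refine ⟨d f, by rw [← map_nsmul, hf, map_zero], fun h0 => hf' ?_⟩
    rw [← map_nsmul] at h0
    exact d.injective (h0.trans (map_zero _).symm)

end IsPadicOrder

end

/-! ### Primes with prescribed quadratic symbols -/

section

open NumberTheorySymbols

theorem jacobiSym.congr_right_of_modEq {a : ℤ} {b b' : ℕ} (hb : Odd b) (hb' : Odd b')
    (h : b ≡ b' [MOD 4 * a.natAbs]) : J(a | b) = J(a | b') := by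
  rw [jacobiSym.mod_right a hb, jacobiSym.mod_right a hb', h]

theorem jacobiSym.eq_one_of_modEq_one {a : ℤ} {b : ℕ} (hb : Odd b)
    (h : b ≡ 1 [MOD 4 * a.natAbs]) : J(a | b) = 1 := by
  rw [jacobiSym.congr_right_of_modEq hb odd_one h, jacobiSym.one_right]

theorem Nat.ModEq.coprime_of_one {b n : ℕ} (h : b ≡ 1 [MOD n]) : b.Coprime n := by
  rw [Nat.Coprime, h.gcd_eq, Nat.gcd_one_left]

/-- If the prime `q` divides `q * e` exactly once, the Jacobi symbol `(q * e / c)` is not determined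
by congruence conditions on `c` away from `q`. -/
theorem exists_modEq_one_jacobiSym_eq_neg_one {q : ℕ} (hq : q.Prime) {e : ℤ} (he : ¬ (q : ℤ) ∣ e)
    {M : ℕ} (hM : ¬ q ∣ M) :
    ∃ c : ℕ, c ≡ 1 [MOD 4 * e.natAbs * M] ∧ Odd c ∧ c.Coprime q ∧ J(q * e | c) = -1 := by
  have he' : ¬ q ∣ e.natAbs := fun h => he (Int.natCast_dvd.2 h)
  have hM1 : ∀ {c : ℕ}, c ≡ 1 [MOD 4 * e.natAbs * M] → c % 4 = 1 := fun {c} hc => by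
    have h4 : c ≡ 1 [MOD 4] := hc.of_dvd ⟨e.natAbs * M, by ring⟩
    exact h4
  -- For `q = 2` take `c ≡ 5` modulo `8`; for odd `q` take a nonresidue modulo `q` and use
  -- quadratic reciprocity.
  rcases hq.eq_two_or_odd' with rfl | hodd
  · have ho : Odd (e.natAbs * M) := by
      rw [Nat.odd_mul, ← Nat.not_even_iff_odd, ← Nat.not_even_iff_odd, even_iff_two_dvd,
        even_iff_two_dvd]
      exact ⟨he', hM⟩
    have hc1 : 1 + 4 * e.natAbs * M ≡ 1 [MOD 4 * e.natAbs * M] := by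
      simp [Nat.ModEq]
    have h8 : (1 + 4 * e.natAbs * M) % 8 = 5 := by
      obtain ⟨t, ht⟩ := ho
      rw [mul_assoc, ht]; omega
    have hco : Odd (1 + 4 * e.natAbs * M) := Nat.odd_iff.2 (by omega)
    refine ⟨_, hc1, hco, Nat.coprime_two_right.2 hco, ?_⟩
    rw [jacobiSym.mul_left, jacobiSym.eq_one_of_modEq_one (a := e) hco (hc1.of_dvd ⟨M, rfl⟩),
      mul_one, Nat.cast_ofNat, jacobiSym.at_two hco, ZMod.χ₈_nat_eq_if_mod_eight]
    rw [if_neg (by omega), if_neg (by omega)]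
  · have : Fact q.Prime := ⟨hq⟩
    obtain ⟨a, ha⟩ := FiniteField.exists_nonsquare (F := ZMod q) (by
      rw [ZMod.ringChar_zmod_n]; rintro rfl; exact absurd hodd (by decide))
    have hcop : q.Coprime (4 * e.natAbs * M) := by
      refine (Nat.Prime.coprime_iff_not_dvd hq).2 fun h => ?_
      rcases hq.dvd_mul.1 h with h | h
      · rcases hq.dvd_mul.1 h with h | h
        · have : q ∣ 2 ^ 2 := h
          have h2 := (Nat.prime_dvd_prime_iff_eq hq Nat.prime_two).1 (hq.dvd_of_dvd_pow this)
          rw [h2] at hodd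
          exact absurd hodd (by decide)
        · exact he' h
      · exact hM h
    obtain ⟨c, hca, hc1⟩ := Nat.chineseRemainder hcop a.val 1
    have hc4 := hM1 hc1
    have hco : Odd c := Nat.odd_iff.2 (by omega)
    have hca' : (c : ZMod q) = a := by
      rw [(ZMod.natCast_eq_natCast_iff _ _ _).2 hca, ZMod.natCast_zmod_val]
    refine ⟨c, hc1, hco, ?_, ?_⟩
    · refine ((Nat.Prime.coprime_iff_not_dvd hq).2 fun h => ?_).symm
      rw [← ZMod.natCast_eq_zero_iff, hca'] at h
      exact ha (h ▸ IsSquare.zero)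
    · rw [jacobiSym.mul_left, jacobiSym.eq_one_of_modEq_one (a := e) hco (hc1.of_dvd ⟨M, rfl⟩),
        mul_one, ← jacobiSym.quadratic_reciprocity_one_mod_four hc4 hodd,
        ← jacobiSym.legendreSym.to_jacobiSym, legendreSym.eq_neg_one_iff]
      rwa [Int.cast_natCast, hca']

/-- If a prime `q` divides one of two integers exactly once and does not divide the other one,
Dirichlet's theorem gives large primes modulo which the first is a nonresidue and the second a
residue. -/
theorem exists_prime_jacobiSym_eq_neg_one_and_eq_one {q : ℕ} (hq : q.Prime) {e d' : ℤ}
    (he : ¬ (q : ℤ) ∣ e) (hd' : ¬ (q : ℤ) ∣ d') (N : ℕ) :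
    ∃ p > N, p.Prime ∧ J(q * e | p) = -1 ∧ J(d' | p) = 1 := by
  have he0 : e.natAbs ≠ 0 := by rintro h; rw [Int.natAbs_eq_zero] at h; simp [h] at he
  have hd0 : d'.natAbs ≠ 0 := by rintro h; rw [Int.natAbs_eq_zero] at h; simp [h] at hd'
  obtain ⟨c, hc1, hco, hcq, hcJ⟩ := exists_modEq_one_jacobiSym_eq_neg_one hq he
    (M := d'.natAbs) (fun h => hd' (Int.natCast_dvd.2 h))
  obtain ⟨p, hpN, hp, hpc⟩ := Nat.forall_exists_prime_gt_and_modEq (max N 2)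
    (q := 4 * e.natAbs * d'.natAbs * q) (a := c) (by have := hq.ne_zero; positivity)
    (hc1.coprime_of_one.mul_right hcq)
  have hpo : Odd p := hp.odd_of_ne_two (by omega)
  refine ⟨p, by omega, hp, ?_, ?_⟩
  · rw [← hcJ]
    refine jacobiSym.congr_right_of_modEq hpo hco (hpc.of_dvd ?_)
    rw [Int.natAbs_mul, Int.natAbs_natCast]
    exact ⟨d'.natAbs, by ring⟩
  · refine jacobiSym.eq_one_of_modEq_one hpo ?_
    exact (hpc.of_dvd ⟨e.natAbs * q, by ring⟩).trans (hc1.of_dvd ⟨e.natAbs, by ring⟩)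

theorem dvd_sub_one_of_modEq {ℓ k p t : ℕ} (hℓ : ℓ.Prime) (ht : ¬ ℓ ∣ t) (hp : p.Prime)
    (h : p ≡ 1 + t * ℓ ^ (k + 1) [MOD ℓ ^ (k + 2)]) :
    ℓ ^ (k + 1) ∣ p - 1 ∧ ¬ ℓ ^ (k + 2) ∣ p - 1 := by
  have h1 : p - 1 ≡ t * ℓ ^ (k + 1) [MOD ℓ ^ (k + 2)] := by
    refine Nat.ModEq.add_left_cancel' 1 ?_
    rwa [Nat.add_sub_cancel' hp.one_le]
  refine ⟨?_, fun hd => ht ?_⟩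
  · exact ((h1.of_dvd (pow_dvd_pow ℓ (by omega : k + 1 ≤ k + 2))).dvd_iff dvd_rfl).2
      (dvd_mul_left _ _)
  · have h2 := (h1.dvd_iff dvd_rfl).1 hd
    rw [show ℓ ^ (k + 2) = ℓ * ℓ ^ (k + 1) by ring] at h2
    exact Nat.dvd_of_mul_dvd_mul_right (pow_pos hℓ.pos _) h2

/-- Let `d` be squarefree with an odd prime factor. For every prime power `ℓ ^ (k + 1)` there are
arbitrarily large primes `p` splitting in `ℚ(√d)` such that `p - 1` is exactly divisible by
`ℓ ^ (k + 1)`. For odd `ℓ`, the condition `p ≡ 1` modulo `4 d` is compatible with the one at `ℓ`.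
For `ℓ = 2` the odd prime factor of `d` serves to adjust the sign of the Jacobi symbol; this is
where `ℚ(i)` and `ℚ(√-2)` are exceptional. -/
theorem exists_prime_jacobiSym_eq_one {d : ℤ} (hd : Squarefree d) {q : ℕ} (hq : q.Prime)
    (hq2 : q ≠ 2) (hqd : (q : ℤ) ∣ d) {ℓ : ℕ} (hℓ : ℓ.Prime) (k N : ℕ) :
    ∃ p > N, p.Prime ∧ J(d | p) = 1 ∧ ℓ ^ (k + 1) ∣ p - 1 ∧ ¬ ℓ ^ (k + 2) ∣ p - 1 := by
  have hd0 : d.natAbs ≠ 0 := Int.natAbs_ne_zero.2 hd.ne_zero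
  rcases eq_or_ne ℓ 2 with rfl | hℓ2
  · obtain ⟨e, rfl⟩ := hqd
    have he : ¬ (q : ℤ) ∣ e := by
      rintro ⟨s, rfl⟩
      have hu := hd q ⟨s, by ring⟩
      exact (Nat.prime_iff_prime_int.1 hq).not_isUnit hu
    obtain ⟨c, hc1, hco, hcq, hcJ⟩ := exists_modEq_one_jacobiSym_eq_neg_one hq he
      (M := 2 ^ (k + 2)) (fun h => hq2
        ((Nat.prime_dvd_prime_iff_eq hq Nat.prime_two).1 (hq.dvd_of_dvd_pow h)))
    obtain ⟨j, m, hm, hdm⟩ := Nat.exists_eq_pow_mul_and_not_dvd hd0 2 (by decide)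
    have hb1 : (1 + 2 ^ (k + 1) * m).Coprime m := by simp
    have hbo : Odd (1 + 2 ^ (k + 1) * m) :=
      odd_one.add_even ((Nat.even_pow.2 ⟨even_two, by omega⟩).mul_right m)
    have hb2 : (1 + 2 ^ (k + 1) * m).Coprime (q * e : ℤ).natAbs := by
      rw [hdm]
      exact ((Nat.coprime_two_right.2 hbo).pow_right j).mul_right hb1
    have hc2 : c ≡ 1 [MOD 2 ^ (k + 2)] := hc1.of_dvd (dvd_mul_left _ _)
    have hcd : c.Coprime (q * e : ℤ).natAbs := by
      rw [Int.natAbs_mul, Int.natAbs_natCast]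
      have hce : c ≡ 1 [MOD e.natAbs] := hc1.of_dvd ⟨4 * 2 ^ (k + 2), by ring⟩
      exact hcq.mul_right hce.coprime_of_one
    -- The class of `1 + 2 ^ (k + 1) * m` modulo `2 ^ (k + 2)` does not change under multiplication
    -- by `c`, while the Jacobi symbol does. The odd part `m` of `d` makes the number prime to `d`.
    obtain ⟨b, hb, hbo', hbd, hbJ⟩ : ∃ b : ℕ, b ≡ 1 + m * 2 ^ (k + 1) [MOD 2 ^ (k + 2)] ∧ Odd b ∧
        b.Coprime (q * e : ℤ).natAbs ∧ J(q * e | b) = 1 := by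
      rcases jacobiSym.eq_one_or_neg_one (a := q * e) (b := 1 + 2 ^ (k + 1) * m) (by
        rw [Int.gcd_eq_natAbs, Int.natAbs_natCast]; exact hb2.symm) with h | h
      · exact ⟨_, by rw [mul_comm], hbo, hb2, h⟩
      · refine ⟨(1 + 2 ^ (k + 1) * m) * c, ?_, hbo.mul hco, hb2.mul_left hcd, ?_⟩
        · simpa [mul_comm m] using (Nat.ModEq.refl (1 + 2 ^ (k + 1) * m)).mul hc2
        · have : NeZero c := ⟨by rintro rfl; exact absurd hco (by decide)⟩
          rw [jacobiSym.mul_right, h, hcJ]; rfl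
    obtain ⟨p, hpN, hp, hpb⟩ := Nat.forall_exists_prime_gt_and_modEq (max N 2)
      (q := 2 ^ (k + 4) * (q * e : ℤ).natAbs) (a := b) (by positivity)
      (((Nat.coprime_two_right.2 hbo').pow_right _).mul_right hbd)
    have hpo : Odd p := hp.odd_of_ne_two (by omega)
    refine ⟨p, by omega, hp, ?_, dvd_sub_one_of_modEq hℓ hm hp ?_⟩
    · rw [← hbJ]
      refine jacobiSym.congr_right_of_modEq hpo hbo' (hpb.of_dvd ⟨2 ^ (k + 2), by ring⟩)
    · exact (hpb.of_dvd ⟨4 * (q * e : ℤ).natAbs, by ring⟩).trans hb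
  -- As `d` is squarefree, `p ≡ 1 + D * ℓ ^ (k + 1)` implies `p ≡ 1` modulo `4 d = ℓ ^ j * D`.
  · obtain ⟨j, D, hD, hdD⟩ := Nat.exists_eq_pow_mul_and_not_dvd (n := 4 * d.natAbs) (by positivity)
      ℓ hℓ.ne_one
    have hj : j ≤ 1 := by
      by_contra! hlt
      have h1 : ℓ ^ 2 ∣ 2 ^ 2 * d.natAbs :=
        (pow_dvd_pow ℓ hlt).trans ⟨D, by rw [← hdD]; rfl⟩
      have h2 : ℓ ^ 2 ∣ d.natAbs :=
        (((Nat.coprime_primes hℓ Nat.prime_two).2 hℓ2).pow 2 2).dvd_of_dvd_mul_left h1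
      have h3 := Int.squarefree_natAbs.2 hd ℓ (by rwa [sq] at h2)
      exact hℓ.ne_one (Nat.isUnit_iff.1 h3)
    have hcop : (1 + D * ℓ ^ (k + 1)).Coprime (D * ℓ ^ (k + 2)) := by
      have h1 : (1 + D * ℓ ^ (k + 1)) ≡ 1 [MOD D] := by simp [Nat.ModEq]
      have h2 : (1 + D * ℓ ^ (k + 1)) ≡ 1 [MOD ℓ] := by
        have : 1 + D * ℓ ^ (k + 1) = 1 + ℓ * (D * ℓ ^ k) := by ring
        rw [this]
        simp [Nat.ModEq]
      exact h1.coprime_of_one.mul_right (h2.coprime_of_one.pow_right _)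
    obtain ⟨p, hpN, hp, hpb⟩ := Nat.forall_exists_prime_gt_and_modEq (max N 2)
      (by
        have : D ≠ 0 := by rintro rfl; exact hD (dvd_zero _)
        have := hℓ.ne_zero
        positivity) hcop
    have hpo : Odd p := hp.odd_of_ne_two (by omega)
    refine ⟨p, by omega, hp, jacobiSym.eq_one_of_modEq_one hpo ?_,
      dvd_sub_one_of_modEq hℓ hD hp (hpb.of_dvd (dvd_mul_left _ _))⟩
    obtain ⟨t, ht⟩ : 4 * d.natAbs ∣ D * ℓ ^ (k + 1) := by
      rw [hdD, mul_comm]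
      exact mul_dvd_mul_left _ (pow_dvd_pow _ (by omega))
    have h1 : p ≡ 1 + D * ℓ ^ (k + 1) [MOD 4 * d.natAbs] :=
      hpb.of_dvd (Dvd.dvd.trans ⟨t, ht⟩ (mul_dvd_mul_left _ (pow_dvd_pow _ (by omega))))
    refine h1.trans ?_
    rw [ht]
    simp [Nat.ModEq]

end

/-! ### The local integers of a Dedekind domain -/

section

open Filter Topology IsDedekindDomain NumberField

section LocalIntegers

open HeightOneSpectrum WithZero

variable {A : Type*} [CommRing A] [IsDedekindDomain A] {K : Type*} [Field K] [Algebra A K]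
  [IsFractionRing A K] {v : HeightOneSpectrum A}

theorem adicCompletionIntegers_dvd_iff {x y : v.adicCompletionIntegers K} :
    x ∣ y ↔ Valued.v (y : v.adicCompletion K) ≤ Valued.v (x : v.adicCompletion K) :=
  (adicCompletionIntegers.integers K v).dvd_iff_le

theorem valued_algebraMap_adicCompletionIntegers (a : A) :
    Valued.v ((algebraMap A (v.adicCompletionIntegers K) a : v.adicCompletionIntegers K) :
      v.adicCompletion K) = v.intValuation a := by
  rw [← valuation_of_algebraMap (K := K)]
  exact valuedAdicCompletion_eq_valuation v a

theorem setOf_valued_le_mem_nhds_zero {c : v.adicCompletion K} (hc : c ≠ 0) :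
    {y : v.adicCompletion K | Valued.v y ≤ Valued.v c} ∈ 𝓝 (0 : v.adicCompletion K) := by
  have h0 : (Valued.v.restrict c) ≠ 0 := by simp [hc]
  refine Filter.mem_of_superset ((Valued.isOpen_closedBall _ h0).mem_nhds (x := 0) (by simp)) ?_
  intro y hy
  exact (Valuation.restrict_le_iff _).1 hy

theorem dvd_mem_nhds_zero {x : v.adicCompletionIntegers K} (hx : x ≠ 0) :
    {y | x ∣ y} ∈ 𝓝 (0 : v.adicCompletionIntegers K) := by
  have hx' : (x : v.adicCompletion K) ≠ 0 := fun h => hx (Subtype.ext h)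
  refine Filter.mem_of_superset (continuous_subtype_val.continuousAt
    (x := (0 : v.adicCompletionIntegers K)) (setOf_valued_le_mem_nhds_zero hx')) ?_
  intro y hy
  exact adicCompletionIntegers_dvd_iff.2 hy

theorem exists_pow_dvd_subset {x : v.adicCompletionIntegers K}
    (hx : Valued.v (x : v.adicCompletion K) < 1) {U : Set (v.adicCompletionIntegers K)}
    (hU : U ∈ 𝓝 0) : ∃ m : ℕ, {y | x ^ m ∣ y} ⊆ U := by
  obtain ⟨U', hU', hUU⟩ := (mem_nhds_subtype _ _ _).1 hU
  obtain ⟨γ, hγ⟩ := Valued.mem_nhds_zero.1 hU'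
  have hγ0 : MonoidWithZeroHom.ValueGroup₀.embedding γ.1 ≠ 0 := by simp
  obtain ⟨m, hm⟩ := exists_exp_neg_natCast_lt hγ0
  refine ⟨m, fun y hy => hUU (hγ ?_)⟩
  rw [Set.mem_ofPred_eq, adicCompletionIntegers_dvd_iff] at hy
  rw [Set.mem_ofPred_eq, Valuation.restrict_lt_iff_lt_embedding]
  refine (hy.trans ?_).trans_lt hm
  have h1 : Valued.v (x : v.adicCompletion K) ≤ exp (-1) := by
    rwa [← lt_mul_exp_iff_le (by simp), ← exp_add, neg_add_cancel, exp_zero]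
  calc Valued.v ((x ^ m : v.adicCompletionIntegers K) : v.adicCompletion K)
      = Valued.v (x : v.adicCompletion K) ^ m := by push_cast; rw [map_pow]
    _ ≤ exp (-1) ^ m := pow_le_pow_left₀ zero_le h1 m
    _ = exp (-(m : ℤ)) := by rw [← exp_nsmul]; simp

/-- Density of `A` in the local integers. -/
theorem exists_dvd_sub_algebraMap (r : v.adicCompletionIntegers K)
    {x : v.adicCompletionIntegers K} (hx : x ≠ 0) :
    ∃ a : A, x ∣ r - algebraMap A (v.adicCompletionIntegers K) a := by
  have hx' : (x : v.adicCompletion K) ≠ 0 := fun h => hx (Subtype.ext h)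
  have hn : (fun y : v.adicCompletion K => (r : v.adicCompletion K) - y) ⁻¹'
      {y | Valued.v y ≤ Valued.v (x : v.adicCompletion K)} ∈ 𝓝 (r : v.adicCompletion K) := by
    refine ContinuousAt.preimage_mem_nhds (by fun_prop) ?_
    rw [sub_self]
    exact setOf_valued_le_mem_nhds_zero hx'
  obtain ⟨k, hk⟩ := (denseRange_algebraMap K v).exists_mem_open isOpen_interior
    ⟨_, mem_interior_iff_mem_nhds.2 hn⟩
  have hk' : Valued.v ((r : v.adicCompletion K) - algebraMap K (v.adicCompletion K) k) ≤
    Valued.v (x : v.adicCompletion K) := (interior_subset hk :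
      _ ∈ (fun y : v.adicCompletion K => (r : v.adicCompletion K) - y) ⁻¹' _)
  have hvk : Valued.v (algebraMap K (v.adicCompletion K) k) = v.valuation K k :=
    valuedAdicCompletion_eq_valuation' v k
  have hk1 : v.valuation K k ≤ 1 := by
    rw [← hvk, ← sub_sub_cancel (r : v.adicCompletion K) (algebraMap K (v.adicCompletion K) k)]
    exact (Valuation.map_sub _ _ _).trans (max_le r.2 (hk'.trans x.2))
  obtain ⟨a, ha⟩ := exists_valuation_sub_lt_of_integer v hk1
    (Units.mk0 (Valued.v (x : v.adicCompletion K)) (by simpa using hx'))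
  refine ⟨a, adicCompletionIntegers_dvd_iff.2 ?_⟩
  have h1 : ((r - algebraMap A (v.adicCompletionIntegers K) a : v.adicCompletionIntegers K) :
      v.adicCompletion K) = ((r : v.adicCompletion K) - algebraMap K (v.adicCompletion K) k) -
        algebraMap K (v.adicCompletion K) (algebraMap A K a - k) := by
    have : ((algebraMap A (v.adicCompletionIntegers K) a : v.adicCompletionIntegers K) :
      v.adicCompletion K) = algebraMap K (v.adicCompletion K) (algebraMap A K a) := rfl
    rw [map_sub, ← this]
    push_cast
    ring
  rw [h1]
  refine (Valuation.map_sub _ _ _).trans (max_le hk' ?_)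
  have h2 : Valued.v (algebraMap K (v.adicCompletion K) (algebraMap A K a - k)) =
    v.valuation K (algebraMap A K a - k) := valuedAdicCompletion_eq_valuation' v _
  rw [h2]
  exact ha.le

theorem isUnit_one_add_of_valued_lt_one {x : v.adicCompletionIntegers K}
    (hx : Valued.v (x : v.adicCompletion K) < 1) : IsUnit (1 + x) := by
  rw [adicCompletionIntegers.isUnit_iff_valued_eq_one]
  exact Valuation.map_one_add_of_lt _ hx

instance : CompleteSpace (v.adicCompletionIntegers K) :=
  (Valued.isClosed_valuationSubring (v.adicCompletion K)).completeSpace_coe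

end LocalIntegers

end

/-! ### The local integers above a rational prime -/

section

open Filter Topology IsDedekindDomain NumberField

section PlacesOver

open HeightOneSpectrum

variable {K : Type*} [Field K] [NumberField K]

/-- The rational prime below a finite place. -/
noncomputable def residueChar (v : HeightOneSpectrum (𝓞 K)) : Nat.Primes :=
  ⟨ringChar (𝓞 K ⧸ v.asIdeal), CharP.char_is_prime (𝓞 K ⧸ v.asIdeal) _⟩

theorem residueChar_eq_iff {v : HeightOneSpectrum (𝓞 K)} {p : Nat.Primes} :
    residueChar v = p ↔ ((p : ℕ) : 𝓞 K) ∈ v.asIdeal := by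
  rw [← Ideal.Quotient.eq_zero_iff_mem, map_natCast]
  constructor
  · rintro rfl
    exact ringChar.Nat.cast_ringChar
  · intro h
    exact Subtype.ext (CharP.ringChar_of_prime_eq_zero p.2 h)

theorem finite_setOf_natCast_mem (K : Type*) [Field K] [NumberField K] {n : ℕ} (hn : n ≠ 0) :
    {v : HeightOneSpectrum (𝓞 K) | (n : 𝓞 K) ∈ v.asIdeal}.Finite := by
  refine (Ideal.finite_factors (I := Ideal.span {(n : 𝓞 K)}) ?_).subset fun v hv => ?_
  · simpa [Ideal.zero_eq_bot] using hn
  · rw [Set.mem_ofPred_eq, Ideal.dvd_span_singleton]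
    exact hv

instance finite_residueChar_fiber (p : Nat.Primes) :
    Finite {v : HeightOneSpectrum (𝓞 K) // residueChar v = p} := by
  simp_rw [residueChar_eq_iff]
  exact (finite_setOf_natCast_mem K p.2.ne_zero).to_subtype

variable (K) in
/-- The ring `𝓞_K ⊗ ℤ_p`, as the product of the local integers at the places above `p`. -/
abbrev SemilocalIntegers (p : Nat.Primes) : Type _ :=
  ∀ v : {v : HeightOneSpectrum (𝓞 K) // residueChar v = p}, v.1.adicCompletionIntegers K

variable {p : Nat.Primes}

theorem SemilocalIntegers.natCast_valued_lt_one
    (v : {v : HeightOneSpectrum (𝓞 K) // residueChar v = p}) :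
    Valued.v (((p : ℕ) : v.1.adicCompletionIntegers K) : v.1.adicCompletion K) < 1 := by
  rw [← map_natCast (algebraMap (𝓞 K) (v.1.adicCompletionIntegers K)),
    valued_algebraMap_adicCompletionIntegers, intValuation_lt_one_iff_mem]
  exact residueChar_eq_iff.1 v.2

theorem SemilocalIntegers.natCast_ne_zero
    (v : {v : HeightOneSpectrum (𝓞 K) // residueChar v = p}) :
    ((p : ℕ) : v.1.adicCompletionIntegers K) ≠ 0 := by
  rw [← map_natCast (algebraMap (𝓞 K) (v.1.adicCompletionIntegers K)), Ne,
    FaithfulSMul.algebraMap_eq_zero_iff]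
  exact_mod_cast p.2.ne_zero

theorem SemilocalIntegers.natCast_pow_dvd_iff {m : ℕ} {r : SemilocalIntegers K p} :
    ((p : ℕ) : SemilocalIntegers K p) ^ m ∣ r ↔
      ∀ v, ((p : ℕ) : v.1.adicCompletionIntegers K) ^ m ∣ r v := by
  rw [pi_dvd_iff]
  rfl

/-- The reduction of `𝓞_K` modulo `p` maps onto that of the product of the local integers above `p`:
approximate at each place and use the Chinese remainder theorem. -/
theorem SemilocalIntegers.exists_dvd_sub_algebraMap (r : SemilocalIntegers K p) :
    ∃ a : 𝓞 K, ((p : ℕ) : SemilocalIntegers K p) ∣ r - algebraMap (𝓞 K) _ a := by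
  cases nonempty_fintype {v : HeightOneSpectrum (𝓞 K) // residueChar v = p}
  choose a ha using fun v => _root_.exists_dvd_sub_algebraMap (A := 𝓞 K) (r v)
    (SemilocalIntegers.natCast_ne_zero v)
  have hp0 : ((p : ℕ) : 𝓞 K) ≠ 0 := by exact_mod_cast p.2.ne_zero
  have hpow : ∀ v : {v : HeightOneSpectrum (𝓞 K) // residueChar v = p}, ∃ n : ℕ,
      WithZero.exp (-(n : ℤ)) < v.1.intValuation ((p : ℕ) : 𝓞 K) := fun v =>
    WithZero.exists_exp_neg_natCast_lt (v.1.intValuation_ne_zero _ hp0)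
  choose n hn using hpow
  obtain ⟨c, hc⟩ := exists_forall_sub_mem_ideal (s := Finset.univ)
    (fun v : {v : HeightOneSpectrum (𝓞 K) // residueChar v = p} => v.1.asIdeal) n
    (fun v _ => v.1.prime) (fun v _ w _ hvw h => hvw (Subtype.ext (HeightOneSpectrum.ext h)))
    (fun v => a v.1)
  refine ⟨c, ?_⟩
  rw [← pow_one ((p : ℕ) : SemilocalIntegers K p), SemilocalIntegers.natCast_pow_dvd_iff]
  intro v
  rw [pow_one]
  have h1 : r v - algebraMap (𝓞 K) (v.1.adicCompletionIntegers K) c =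
      (r v - algebraMap (𝓞 K) (v.1.adicCompletionIntegers K) (a v)) -
        algebraMap (𝓞 K) (v.1.adicCompletionIntegers K) (c - a v) := by rw [map_sub]; ring
  change _ ∣ r v - algebraMap (𝓞 K) (v.1.adicCompletionIntegers K) c
  rw [h1]
  refine dvd_sub (ha v) ?_
  rw [adicCompletionIntegers_dvd_iff, valued_algebraMap_adicCompletionIntegers,
    ← map_natCast (algebraMap (𝓞 K) (v.1.adicCompletionIntegers K)),
    valued_algebraMap_adicCompletionIntegers]
  exact ((v.1.intValuation_le_pow_iff_mem _ _).2 (hc v (Finset.mem_univ v))).trans (hn v).le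

/-- Divisibility by `p` in `𝓞_K` can be tested at the places above `p`, as `p` is a unit
elsewhere. -/
theorem SemilocalIntegers.dvd_of_natCast_dvd_algebraMap {a : 𝓞 K}
    (h : ((p : ℕ) : SemilocalIntegers K p) ∣ algebraMap (𝓞 K) _ a) : ((p : ℕ) : 𝓞 K) ∣ a := by
  have hp0 : ((p : ℕ) : 𝓞 K) ≠ 0 := by exact_mod_cast p.2.ne_zero
  have hp0' : algebraMap (𝓞 K) K ((p : ℕ) : 𝓞 K) ≠ 0 := by
    rwa [Ne, FaithfulSMul.algebraMap_eq_zero_iff]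
  have key : ∀ v : HeightOneSpectrum (𝓞 K), v.intValuation a ≤ v.intValuation ((p : ℕ) : 𝓞 K) := by
    intro v
    by_cases hv : residueChar v = p
    · rw [← pow_one ((p : ℕ) : SemilocalIntegers K p), SemilocalIntegers.natCast_pow_dvd_iff] at h
      have h1 := h ⟨v, hv⟩
      rw [pow_one] at h1
      have h2 : ((p : ℕ) : v.adicCompletionIntegers K) ∣
        algebraMap (𝓞 K) (v.adicCompletionIntegers K) a := h1
      rwa [adicCompletionIntegers_dvd_iff, valued_algebraMap_adicCompletionIntegers,
        ← map_natCast (algebraMap (𝓞 K) (v.adicCompletionIntegers K)),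
        valued_algebraMap_adicCompletionIntegers] at h2
    · rw [residueChar_eq_iff] at hv
      rw [intValuation_eq_one_iff.2 hv]
      exact v.intValuation_le_one a
  obtain ⟨c, hc⟩ := HeightOneSpectrum.mem_integers_of_valuation_le_one (R := 𝓞 K) K
    (algebraMap (𝓞 K) K a / algebraMap (𝓞 K) K ((p : ℕ) : 𝓞 K)) fun v => by
      rw [map_div₀, valuation_of_algebraMap, valuation_of_algebraMap]
      exact div_le_one_of_le₀ (key v) zero_le
  refine ⟨c, ?_⟩
  apply FaithfulSMul.algebraMap_injective (𝓞 K) K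
  rw [map_mul, hc, mul_div_cancel₀ _ hp0']

/-- The product of the local integers above `p` is a `ℤ_p`-order, with any `ℤ`-basis of the ring of
integers as `ℤ_p`-basis. -/
theorem SemilocalIntegers.isPadicOrder {ι : Type*} [Fintype ι] (B : Module.Basis ι ℤ (𝓞 K))
    (p : Nat.Primes) :
    IsPadicOrder (p : ℕ) (fun i => algebraMap (𝓞 K) (SemilocalIntegers K p) (B i)) where
  mem_nhds m := by
    simp only [SemilocalIntegers.natCast_pow_dvd_iff]
    rw [Set.ofPred_forall]
    refine Filter.iInter_mem.2 fun v => ?_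
    exact (continuous_apply v).continuousAt (x := (0 : SemilocalIntegers K p))
      (dvd_mem_nhds_zero (pow_ne_zero m (natCast_ne_zero v)))
  basis U hU := by
    cases nonempty_fintype {v : HeightOneSpectrum (𝓞 K) // residueChar v = p}
    rw [nhds_pi, Filter.mem_pi] at hU
    obtain ⟨I, -, t, ht, hI⟩ := hU
    choose m hm using fun v => exists_pow_dvd_subset (natCast_valued_lt_one v) (ht v)
    refine ⟨Finset.univ.sup m, fun r hr => hI fun v _ => hm v ?_⟩
    rw [Set.mem_ofPred_eq, SemilocalIntegers.natCast_pow_dvd_iff] at hr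
    exact (pow_dvd_pow _ (Finset.le_sup (Finset.mem_univ v))).trans (hr v)
  eq_zero_of_mul r hr := by
    funext v
    exact (mul_eq_zero.1 (congrFun hr v)).resolve_left (natCast_ne_zero v)
  span r := by
    obtain ⟨a, ha⟩ := exists_dvd_sub_algebraMap r
    refine ⟨fun i => B.repr a i, ?_⟩
    have : algebraMap (𝓞 K) (SemilocalIntegers K p) a =
        ∑ i, B.repr a i • algebraMap (𝓞 K) (SemilocalIntegers K p) (B i) := by
      conv_lhs => rw [← B.sum_repr a]
      rw [map_sum]
      simp only [map_zsmul]
    rwa [← this]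
  indep x hx := by
    have : ∑ i, x i • algebraMap (𝓞 K) (SemilocalIntegers K p) (B i) =
        algebraMap (𝓞 K) (SemilocalIntegers K p) (∑ i, x i • B i) := by
      rw [map_sum]
      simp only [map_zsmul]
    rw [this] at hx
    obtain ⟨c, hc⟩ := dvd_of_natCast_dvd_algebraMap hx
    intro i
    refine ⟨B.repr c i, ?_⟩
    have h1 : ((p : ℕ) : 𝓞 K) * c = ((p : ℕ) : ℤ) • c := by simp
    have h2 := congrArg (fun y => B.repr y i) hc
    simp only [h1, map_smul, B.repr_sum_self] at h2
    exact h2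
  isUnit_one_add r := by
    rw [Pi.isUnit_iff]
    intro v
    refine isUnit_one_add_of_valued_lt_one (x := ((p : ℕ) : v.1.adicCompletionIntegers K) * r v) ?_
    push_cast
    rw [map_mul]
    exact mul_lt_one_of_lt_of_le (natCast_valued_lt_one v) (r v).2

end PlacesOver

end

/-! ### Quadratic fields and their split primes -/

section

open NumberField NumberTheorySymbols

/-- The field `K` is generated over `ℚ` by the square root `δ` of the integer `d`. -/
structure IsSqrtGenerator {K : Type*} [Field K] [CharZero K] (d : ℤ) (δ : K) : Prop where
  sq_eq : δ ^ 2 = d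
  exists_eq : ∀ z : K, ∃ a b : ℚ, z = a + b * δ

section Quadratic

variable {K : Type*} [Field K]

theorem exists_eq_add_mul_of_finrank_eq_two [CharZero K] (h2 : Module.finrank ℚ K = 2) {y : K}
    (hy : ∀ a : ℚ, y ≠ a) (z : K) : ∃ a b : ℚ, z = a + b * y := by
  have hli : LinearIndependent ℚ ![(1 : K), y] := by
    rw [LinearIndependent.pair_iff]
    intro s t hst
    rw [Rat.smul_def, Rat.smul_def, mul_one] at hst
    have ht : t = 0 := by
      by_contra ht
      refine hy (-s / t) ?_
      have : (t : K) ≠ 0 := by exact_mod_cast ht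
      push_cast
      field_simp
      linear_combination hst
    subst ht
    refine ⟨?_, rfl⟩
    simpa using hst
  have : FiniteDimensional ℚ K := FiniteDimensional.of_finrank_eq_succ h2
  have hspan := hli.span_eq_top_of_card_eq_finrank' (by simp [h2])
  have hz : z ∈ Submodule.span ℚ (Set.range ![(1 : K), y]) := hspan ▸ Submodule.mem_top
  rw [Matrix.range_cons, Matrix.range_cons, Matrix.range_empty, Set.union_empty,
    Set.singleton_union, Submodule.mem_span_pair] at hz
  obtain ⟨a, b, hab⟩ := hz
  exact ⟨a, b, by rw [← hab, Rat.smul_def, Rat.smul_def, mul_one]⟩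

/-- Complete the square for a generator and remove the denominator and the square factors. -/
theorem exists_isSqrtGenerator_of_finrank_eq_two [CharZero K] (h2 : Module.finrank ℚ K = 2) :
    ∃ (d : ℤ) (δ : K), Squarefree d ∧ IsSqrtGenerator d δ := by
  obtain ⟨x, hx⟩ : ∃ x : K, ∀ a : ℚ, x ≠ a := by
    by_contra! hno
    have : Module.finrank ℚ K ≤ 1 := finrank_le_one 1 fun w => by
      obtain ⟨a, ha⟩ := hno w
      exact ⟨a, by rw [Rat.smul_def, ha, mul_one]⟩
    omega
  obtain ⟨a, b, hab⟩ := exists_eq_add_mul_of_finrank_eq_two h2 hx (x ^ 2)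
  set y : K := x - (b / 2 : ℚ) with hy
  have hyQ : ∀ c : ℚ, y ≠ c := fun c hc => hx (c + b / 2) (by
    push_cast; push_cast at hy; rw [← hc, hy]; ring)
  set r : ℚ := a + b ^ 2 / 4 with hr
  have hyr : y ^ 2 = r := by
    rw [hy, hr]; push_cast; linear_combination hab
  have hr0 : r ≠ 0 := by
    intro h
    rw [h, Rat.cast_zero] at hyr
    exact hyQ 0 (by rw [Rat.cast_zero]; exact pow_eq_zero_iff two_ne_zero |>.1 hyr)
  obtain ⟨m, s, hms, hm⟩ := Nat.sq_mul_squarefree (r.num * r.den).natAbs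
  have hD0 : (r.num * r.den).natAbs ≠ 0 :=
    Int.natAbs_ne_zero.2 (mul_ne_zero (Rat.num_ne_zero.2 hr0) (by exact_mod_cast r.den_ne_zero))
  have hs0 : s ≠ 0 := by rintro rfl; apply hD0; rw [← hms]; ring
  set d : ℤ := (r.num * r.den).sign * m with hd
  have hdD : r.num * r.den = (s : ℤ) ^ 2 * d := by
    conv_lhs => rw [← Int.sign_mul_natAbs (r.num * r.den), ← hms]
    rw [hd]; push_cast; ring
  have hdsq : Squarefree d := by
    rw [← Int.squarefree_natAbs, hd, Int.natAbs_mul, Int.natAbs_natCast, Int.natAbs_sign,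
      if_neg (by simpa using hD0), one_mul]
    exact hm
  have hden : (r.den : K) ≠ 0 := by exact_mod_cast r.den_ne_zero
  have hsK : (s : K) ≠ 0 := by exact_mod_cast hs0
  refine ⟨d, r.den * y / s, hdsq, ⟨?_, fun z => ?_⟩⟩
  · have h1 : (r : K) * r.den = r.num := by
      exact_mod_cast congrArg (Rat.cast : ℚ → K) r.mul_den_eq_num
    have h3 : ((r.num : K) * r.den) = (s : K) ^ 2 * d := by
      exact_mod_cast congrArg (Int.cast : ℤ → K) hdD
    field_simp
    rw [hyr]
    linear_combination (r.den : K) * h1 + h3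
  · obtain ⟨u, w, huw⟩ := exists_eq_add_mul_of_finrank_eq_two h2 hyQ z
    refine ⟨u, w * s / r.den, ?_⟩
    rw [huw]
    push_cast
    field_simp

theorem IsSqrtGenerator.ne_ratCast [CharZero K] {d : ℤ} {δ : K} (h : IsSqrtGenerator d δ)
    (hd : d < 0) (a : ℚ) : δ ≠ a := by
  intro ha
  have h1 := h.sq_eq
  rw [ha] at h1
  have h2 : a ^ 2 = (d : ℚ) := by exact_mod_cast h1
  have h3 : (d : ℚ) < 0 := by exact_mod_cast hd
  nlinarith [sq_nonneg a]

/-- In a totally complex field the integer `d` is negative. -/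
theorem IsSqrtGenerator.neg [NumberField K] [IsTotallyComplex K] {d : ℤ} {δ : K}
    (h : IsSqrtGenerator d δ) : d < 0 := by
  by_contra! hd
  obtain ⟨w⟩ := (inferInstance : Nonempty (InfinitePlace K))
  have hw := IsTotallyComplex.isComplex w
  rw [InfinitePlace.isComplex_iff, ComplexEmbedding.isReal_iff] at hw
  apply hw
  ext z
  obtain ⟨a, b, rfl⟩ := h.exists_eq z
  have h1 : (w.embedding δ) ^ 2 = ((Real.sqrt d : ℝ) : ℂ) ^ 2 := by
    rw [← map_pow, h.sq_eq, map_intCast, ← Complex.ofReal_pow,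
      Real.sq_sqrt (by exact_mod_cast hd), Complex.ofReal_intCast]
  have h2 : (starRingEnd ℂ) (w.embedding δ) = w.embedding δ := by
    rcases sq_eq_sq_iff_eq_or_eq_neg.1 h1 with h | h <;> rw [h]
    · exact Complex.conj_ofReal _
    · rw [map_neg, Complex.conj_ofReal]
  rw [ComplexEmbedding.conjugate_coe_eq]
  simp [h2]

theorem IsSqrtGenerator.nonempty_quadraticAlgebra_equiv [CharZero K] {d : ℤ} {δ : K}
    (h : IsSqrtGenerator d δ) (hd : d < 0) : Nonempty (QuadraticAlgebra ℚ (d : ℚ) 0 ≃+* K) := by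
  let f : QuadraticAlgebra ℚ (d : ℚ) 0 →ₐ[ℚ] K :=
    QuadraticAlgebra.lift ⟨δ, by rw [← sq, h.sq_eq]; simp [Algebra.smul_def]⟩
  have hf : ∀ z, f z = z.re + z.im * δ := fun z => by
    simp [f, Algebra.smul_def]
  refine ⟨RingEquiv.ofBijective f ⟨?_, fun z => ?_⟩⟩
  · rw [injective_iff_map_eq_zero]
    intro z hz
    rw [hf] at hz
    have him : z.im = 0 := by
      by_contra him
      refine h.ne_ratCast hd (-z.re / z.im) ?_
      have : (z.im : K) ≠ 0 := by exact_mod_cast him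
      push_cast
      field_simp
      linear_combination hz
    rw [him, Rat.cast_zero, zero_mul, add_zero] at hz
    have hre : z.re = 0 := by exact_mod_cast hz
    ext <;> simp [him, hre]
  · obtain ⟨a, b, rfl⟩ := h.exists_eq z
    exact ⟨⟨a, b⟩, hf _⟩

/-- Two fields generated by a square root of the same negative integer are isomorphic. -/
theorem IsSqrtGenerator.nonempty_ringEquiv {L : Type*} [Field L] [CharZero K] [CharZero L] {d : ℤ}
    {δ : K} {ε : L} (hδ : IsSqrtGenerator d δ) (hε : IsSqrtGenerator d ε) (hd : d < 0) :
    Nonempty (K ≃+* L) := by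
  obtain ⟨f⟩ := hδ.nonempty_quadraticAlgebra_equiv hd
  obtain ⟨g⟩ := hε.nonempty_quadraticAlgebra_equiv hd
  exact ⟨f.symm.trans g⟩

/-- The subfield of `ℂ` generated by a square root of an integer. -/
theorem isSqrtGenerator_adjoin {d : ℤ} {ε : ℂ} (hε : ε ^ 2 = d) :
    IsSqrtGenerator d (⟨ε, IntermediateField.mem_adjoin_simple_self ℚ ε⟩ :
      IntermediateField.adjoin ℚ {ε}) where
  sq_eq := Subtype.ext (by push_cast; exact hε)
  exists_eq z := by
    have halg : IsAlgebraic ℚ ε := by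
      refine IsIntegral.isAlgebraic (IsIntegral.of_pow two_pos ?_)
      rw [hε]
      exact_mod_cast isIntegral_algebraMap (R := ℚ) (A := ℂ) (x := (d : ℚ))
    have hz : (z : ℂ) ∈ Algebra.adjoin ℚ {ε} := by
      rw [← IntermediateField.adjoin_simple_toSubalgebra_of_isAlgebraic halg]
      exact z.2
    have : ∃ a b : ℚ, (z : ℂ) = a + b * ε := by
      refine Algebra.adjoin_induction (p := fun x _ => ∃ a b : ℚ, x = a + b * ε) ?_ ?_ ?_ ?_ hz
      · rintro x rfl
        exact ⟨0, 1, by simp⟩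
      · intro r
        exact ⟨r, 0, by simp⟩
      · rintro x y - - ⟨a, b, rfl⟩ ⟨a', b', rfl⟩
        exact ⟨a + a', b + b', by push_cast; ring⟩
      · rintro x y - - ⟨a, b, rfl⟩ ⟨a', b', rfl⟩
        exact ⟨a * a' + b * b' * d, a * b' + a' * b, by
          push_cast; linear_combination (b * b' : ℂ) * hε⟩
    obtain ⟨a, b, hab⟩ := this
    exact ⟨a, b, Subtype.ext (by rw [hab]; push_cast; rfl)⟩

end Quadratic

section Splitting

variable {K : Type*} [Field K] [NumberField K]

/-- The order `ℤ[δ]` has finite index in the ring of integers. -/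
theorem IsSqrtGenerator.exists_mul_eq {d : ℤ} {δ : 𝓞 K} (h : IsSqrtGenerator d (δ : K)) :
    ∃ N : ℕ, N ≠ 0 ∧ ∀ x : 𝓞 K, ∃ a b : ℤ, (N : 𝓞 K) * x = a + b * δ := by
  classical
  have B := RingOfIntegers.basis K
  have hB : ∀ i, ∃ n : ℕ, n ≠ 0 ∧ ∃ a b : ℤ, (n : 𝓞 K) * B i = a + b * δ := by
    intro i
    obtain ⟨a, b, hab⟩ := h.exists_eq (algebraMap (𝓞 K) K (B i))
    refine ⟨a.den * b.den, mul_ne_zero a.den_ne_zero b.den_ne_zero,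
      a.num * b.den, b.num * a.den, ?_⟩
    apply FaithfulSMul.algebraMap_injective (𝓞 K) K
    rw [map_mul, hab, map_add, map_mul]
    simp only [map_mul, map_natCast, map_intCast, Nat.cast_mul]
    push_cast
    have ha : (a : K) * a.den = a.num := by
      exact_mod_cast congrArg (Rat.cast : ℚ → K) a.mul_den_eq_num
    have hb : (b : K) * b.den = b.num := by
      exact_mod_cast congrArg (Rat.cast : ℚ → K) b.mul_den_eq_num
    rw [← ha, ← hb]; ring
  choose n hn a b hab using hB
  refine ⟨∏ i, n i, Finset.prod_ne_zero_iff.2 fun i _ => hn i, fun x => ?_⟩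
  refine ⟨∑ i, B.repr x i * ((∏ j ∈ Finset.univ.erase i, n j : ℕ) : ℤ) * a i,
    ∑ i, B.repr x i * ((∏ j ∈ Finset.univ.erase i, n j : ℕ) : ℤ) * b i, ?_⟩
  conv_lhs => rw [← B.sum_repr x]
  rw [Finset.mul_sum, Int.cast_sum, Int.cast_sum, Finset.sum_mul, ← Finset.sum_add_distrib]
  refine Finset.sum_congr rfl fun i _ => ?_
  rw [← Finset.mul_prod_erase _ _ (Finset.mem_univ i), zsmul_eq_mul]
  push_cast
  linear_combination ((B.repr x i : ℤ) : 𝓞 K) * (∏ j ∈ Finset.univ.erase i, (n j : 𝓞 K)) * hab i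

theorem intCast_dvd_pow_sub_self {p : ℕ} (hp : p.Prime) (a : ℤ) : (p : ℤ) ∣ a ^ p - a := by
  have : Fact p.Prime := ⟨hp⟩
  rw [← ZMod.intCast_zmod_eq_zero_iff_dvd]
  push_cast
  rw [ZMod.pow_card, sub_self]

theorem intCast_dvd_pow_half_sub_jacobiSym {p : ℕ} (hp : p.Prime) (d : ℤ) :
    (p : ℤ) ∣ d ^ (p / 2) - J(d | p) := by
  have : Fact p.Prime := ⟨hp⟩
  rw [← ZMod.intCast_zmod_eq_zero_iff_dvd, ← jacobiSym.legendreSym.to_jacobiSym]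
  push_cast
  rw [legendreSym.eq_pow, sub_self]

/-- If `d` is a nonzero square modulo the large prime `p`, then the Frobenius is trivial on
`𝓞_K / p`. This encodes that `p` splits completely. The bound ensures that `p` does not divide the
index of `ℤ[δ]`. -/
theorem IsSqrtGenerator.exists_forall_dvd_pow_sub_self {d : ℤ} {δ : 𝓞 K}
    (h : IsSqrtGenerator d (δ : K)) :
    ∃ N : ℕ, ∀ p > N, p.Prime → J(d | p) = 1 → ∀ x : 𝓞 K, (p : 𝓞 K) ∣ x ^ p - x := by
  obtain ⟨N, hN, hx⟩ := h.exists_mul_eq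
  refine ⟨max N 2, fun p hpN hp hJ x => ?_⟩
  have hpo : Odd p := hp.odd_of_ne_two (by omega)
  have hcast : ∀ {a : ℤ}, (p : ℤ) ∣ a → (p : 𝓞 K) ∣ (a : 𝓞 K) := fun {a} ha => by
    obtain ⟨c, rfl⟩ := ha
    exact ⟨c, by push_cast; rfl⟩
  have hint : ∀ a : ℤ, (p : 𝓞 K) ∣ (a : 𝓞 K) ^ p - a := fun a => by
    have := hcast (intCast_dvd_pow_sub_self hp a)
    push_cast at this
    exact this
  have hδ2 : δ ^ 2 = (d : 𝓞 K) := RingOfIntegers.ext (by push_cast; exact h.sq_eq)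
  have hδ : (p : 𝓞 K) ∣ δ ^ p - δ := by
    have h1 := hcast (intCast_dvd_pow_half_sub_jacobiSym hp d)
    rw [hJ] at h1
    push_cast at h1
    have h2 : δ ^ p = δ * (d : 𝓞 K) ^ (p / 2) := by
      rw [← hδ2, ← pow_mul, ← pow_succ', Nat.two_mul_div_two_add_one_of_odd hpo]
    have : δ ^ p - δ = δ * ((d : 𝓞 K) ^ (p / 2) - 1) := by rw [h2]; ring
    rw [this]
    exact h1.mul_left _
  obtain ⟨a, b, hab⟩ := hx x
  obtain ⟨r, hr⟩ := exists_add_pow_prime_eq hp (a : 𝓞 K) (b * δ)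
  have h1 : (p : 𝓞 K) ∣ ((N : 𝓞 K) * x) ^ p - (N : 𝓞 K) * x := by
    have : ((N : 𝓞 K) * x) ^ p - (N : 𝓞 K) * x = ((a : 𝓞 K) ^ p - a) +
        ((b : 𝓞 K) ^ p * (δ ^ p - δ) + δ * ((b : 𝓞 K) ^ p - b)) + p * (a * (b * δ) * r) := by
      rw [hab, hr]; ring
    rw [this]
    exact dvd_add (dvd_add (hint a) (dvd_add (hδ.mul_left _) ((hint b).mul_left _)))
      (dvd_mul_right _ _)
  have h2 : (p : 𝓞 K) ∣ (N : 𝓞 K) * (x ^ p - x) := by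
    have : (N : 𝓞 K) * (x ^ p - x) = (((N : 𝓞 K) * x) ^ p - (N : 𝓞 K) * x) -
        x ^ p * (((N : ℤ) : 𝓞 K) ^ p - ((N : ℤ) : 𝓞 K)) := by push_cast; ring
    rw [this]
    exact dvd_sub h1 ((hint N).mul_left _)
  have h3 : IsCoprime (p : 𝓞 K) (N : 𝓞 K) := by
    have hco : Nat.Coprime p N := (Nat.Prime.coprime_iff_not_dvd hp).2 fun hd =>
      absurd (Nat.le_of_dvd (Nat.pos_of_ne_zero hN) hd) (by omega)
    have := (Nat.isCoprime_iff_coprime.2 hco).map (Int.castRingHom (𝓞 K))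
    simpa using this
  exact h3.dvd_of_dvd_mul_left h2

variable {p : Nat.Primes}

theorem SemilocalIntegers.dvd_pow_sub_self (h : ∀ x : 𝓞 K, ((p : ℕ) : 𝓞 K) ∣ x ^ (p : ℕ) - x)
    (r : SemilocalIntegers K p) : ((p : ℕ) : SemilocalIntegers K p) ∣ r ^ (p : ℕ) - r := by
  obtain ⟨a, ha⟩ := SemilocalIntegers.exists_dvd_sub_algebraMap r
  have h1 : ((p : ℕ) : SemilocalIntegers K p) ∣
      algebraMap (𝓞 K) _ a ^ (p : ℕ) - algebraMap (𝓞 K) _ a := by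
    have := map_dvd (algebraMap (𝓞 K) (SemilocalIntegers K p)) (h a)
    simpa using this
  have h2 := ha.trans (sub_dvd_pow_sub_pow r (algebraMap (𝓞 K) _ a) p)
  have : r ^ (p : ℕ) - r = (r ^ (p : ℕ) - algebraMap (𝓞 K) _ a ^ (p : ℕ)) +
    (algebraMap (𝓞 K) _ a ^ (p : ℕ) - algebraMap (𝓞 K) _ a) - (r - algebraMap (𝓞 K) _ a) := by ring
  rw [this]
  exact dvd_sub (dvd_add h2 h1) ha

theorem SemilocalIntegers.dvd_unit_pow_sub_one
    (h : ∀ x : 𝓞 K, ((p : ℕ) : 𝓞 K) ∣ x ^ (p : ℕ) - x) (u : (SemilocalIntegers K p)ˣ) :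
    ((p : ℕ) : SemilocalIntegers K p) ∣ (u : SemilocalIntegers K p) ^ ((p : ℕ) - 1) - 1 := by
  have h1 := SemilocalIntegers.dvd_pow_sub_self h u
  have h2 : (u : SemilocalIntegers K p) ^ (p : ℕ) - u =
      u * ((u : SemilocalIntegers K p) ^ ((p : ℕ) - 1) - 1) := by
    rw [mul_sub, mul_one, ← pow_succ', Nat.sub_add_cancel p.2.one_le]
  rw [h2] at h1
  exact u.dvd_mul_left.1 h1

end Splitting

end

/-! ### Products of topological groups -/

section

open Filter Topology NumberField

namespace ContinuousMulEquiv

variable {ι β : Type*}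

/-- A product of isomorphisms of topological groups. -/
@[to_additive /-- A product of isomorphisms of topological additive groups. -/]
def piCongrRight {M N : ι → Type*} [∀ i, Mul (M i)] [∀ i, Mul (N i)]
    [∀ i, TopologicalSpace (M i)] [∀ i, TopologicalSpace (N i)] (e : ∀ i, M i ≃ₜ* N i) :
    (∀ i, M i) ≃ₜ* ∀ i, N i where
  __ := MulEquiv.piCongrRight fun i => (e i).toMulEquiv
  continuous_toFun := continuous_pi fun i => (e i).continuous_toFun.comp (continuous_apply i)
  continuous_invFun := continuous_pi fun i => (e i).continuous_invFun.comp (continuous_apply i)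

/-- A binary product of isomorphisms of topological groups. -/
@[to_additive ContinuousAddEquiv.prodCongr
/-- A binary product of isomorphisms of topological additive groups. -/]
def prodCongr {M N M' N' : Type*} [MulOneClass M] [MulOneClass N]
    [MulOneClass M'] [MulOneClass N'] [TopologicalSpace M]
    [TopologicalSpace N] [TopologicalSpace M'] [TopologicalSpace N'] (e : M ≃ₜ* M')
    (f : N ≃ₜ* N') : (M × N) ≃ₜ* (M' × N') where
  __ := MulEquiv.prodCongr e.toMulEquiv f.toMulEquiv
  continuous_toFun := e.continuous_toFun.prodMap f.continuous_toFun
  continuous_invFun := e.continuous_invFun.prodMap f.continuous_invFun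

/-- Grouping the factors of a product along the fibres of a map of the index set. -/
@[to_additive /-- Grouping the factors of a product along the fibres of a map of the index set. -/]
def piFiberwise (f : ι → β) (M : ι → Type*) [∀ i, Mul (M i)] [∀ i, TopologicalSpace (M i)] :
    (∀ i, M i) ≃ₜ* ∀ b, ∀ i : {i // f i = b}, M i.1 where
  toFun x _ i := x i.1
  invFun y i := y (f i) ⟨i, rfl⟩
  left_inv _ := rfl
  right_inv y := by
    ext b ⟨i, rfl⟩
    rfl
  map_mul' _ _ := rfl
  continuous_toFun := by fun_prop
  continuous_invFun := continuous_pi fun i => by fun_prop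

/-- The additive version of an isomorphism of topological groups. -/
def toAdditive {M N : Type*} [MulOneClass M] [MulOneClass N] [TopologicalSpace M]
    [TopologicalSpace N] (e : M ≃ₜ* N) : Additive M ≃ₜ+ Additive N where
  __ := MulEquiv.toAdditive e.toMulEquiv
  continuous_toFun := e.continuous_toFun
  continuous_invFun := e.continuous_invFun

/-- The multiplicative version of an isomorphism of topological additive groups. -/
def _root_.ContinuousAddEquiv.toMultiplicative {M N : Type*} [AddZeroClass M] [AddZeroClass N]
    [TopologicalSpace M] [TopologicalSpace N] (e : M ≃ₜ+ N) :
    Multiplicative M ≃ₜ* Multiplicative N where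
  __ := AddEquiv.toMultiplicative e.toAddEquiv
  continuous_toFun := e.continuous_toFun
  continuous_invFun := e.continuous_invFun

/-- Multiplicative isomorphisms from additive ones. -/
def ofAdditive {M N : Type*} [MulOneClass M] [MulOneClass N] [TopologicalSpace M]
    [TopologicalSpace N] (e : Additive M ≃ₜ+ Additive N) : M ≃ₜ* N where
  __ := MulEquiv.toAdditive.symm e.toAddEquiv
  continuous_toFun := e.continuous_toFun
  continuous_invFun := e.continuous_invFun

/-- The additive version of a product of topological groups. -/
def additivePi (M : ι → Type*) [∀ i, Mul (M i)] [∀ i, TopologicalSpace (M i)] :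
    Additive (∀ i, M i) ≃ₜ+ ∀ i, Additive (M i) where
  toFun x i := Additive.ofMul (x.toMul i)
  invFun y := Additive.ofMul fun i => (y i).toMul
  left_inv _ := rfl
  right_inv _ := rfl
  map_add' _ _ := rfl
  continuous_toFun := continuous_pi fun i => continuous_apply (A := M) i
  continuous_invFun := continuous_pi (A := M) fun i => continuous_apply i

end ContinuousMulEquiv

namespace ContinuousAddEquiv

variable {ι κ : Type*}

/-- Currying for a product indexed by a sigma type. -/
def piSigmaCurry {J : ι → Type*} (M : ∀ i, J i → Type*) [∀ i j, Add (M i j)]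
    [∀ i j, TopologicalSpace (M i j)] :
    (∀ x : Σ i, J i, M x.1 x.2) ≃ₜ+ ∀ i j, M i j where
  toFun x i j := x ⟨i, j⟩
  invFun y x := y x.1 x.2
  left_inv _ := rfl
  right_inv _ := rfl
  map_add' _ _ := rfl
  continuous_toFun := by fun_prop
  continuous_invFun := by fun_prop

/-- A product of binary products is a binary product of products. -/
def piProd (M N : ι → Type*) [∀ i, Add (M i)] [∀ i, Add (N i)]
    [∀ i, TopologicalSpace (M i)] [∀ i, TopologicalSpace (N i)] :
    (∀ i, M i × N i) ≃ₜ+ (∀ i, M i) × ∀ i, N i where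
  toFun x := (fun i => (x i).1, fun i => (x i).2)
  invFun y i := (y.1 i, y.2 i)
  left_inv _ := rfl
  right_inv _ := rfl
  map_add' _ _ := rfl
  continuous_toFun := by fun_prop
  continuous_invFun := by fun_prop

/-- Reindexing a power of a topological additive group. -/
def arrowCongrLeft (e : ι ≃ κ) (M : Type*) [Add M] [TopologicalSpace M] :
    (ι → M) ≃ₜ+ (κ → M) where
  toFun x k := x (e.symm k)
  invFun y i := y (e i)
  left_inv _ := by simp
  right_inv _ := by simp
  map_add' _ _ := rfl
  continuous_toFun := by fun_prop
  continuous_invFun := by fun_prop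

end ContinuousAddEquiv

/-- Isomorphic discrete additive groups are isomorphic as topological groups. -/
def AddEquiv.toContinuousAddEquivOfDiscrete {M N : Type*} [Add M] [Add N] [TopologicalSpace M]
    [TopologicalSpace N] [DiscreteTopology M] [DiscreteTopology N] (e : M ≃+ N) : M ≃ₜ+ N where
  __ := e
  continuous_toFun := continuous_of_discreteTopology
  continuous_invFun := continuous_of_discreteTopology

/-- The cyclic factors of order `m` of a product of cyclic groups form a power of `ℤ/m`. -/
def piZModFibreEquiv {I : Type*} (n : I → ℕ) (m : ℕ) :
    (∀ i : {i // n i = m}, ZMod (n i.1)) ≃ₜ+ ({i // n i = m} → ZMod m) :=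
  .piCongrRight fun i => (ZMod.ringEquivCongr i.2).toAddEquiv.toContinuousAddEquivOfDiscrete

/-- Two countable products of cyclic groups of prime power order in which every prime power occurs
infinitely often are isomorphic. Trivial factors are allowed. -/
theorem nonempty_pi_zmod_continuousAddEquiv {I I' : Type*} [Countable I] [Countable I']
    (n : I → ℕ) (n' : I' → ℕ) (hn : ∀ i, n i ≠ 1 → IsPrimePow (n i))
    (hn' : ∀ i, n' i ≠ 1 → IsPrimePow (n' i))
    (hinf : ∀ m, IsPrimePow m → Infinite {i // n i = m})
    (hinf' : ∀ m, IsPrimePow m → Infinite {i // n' i = m}) :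
    Nonempty ((∀ i, ZMod (n i)) ≃ₜ+ ∀ i, ZMod (n' i)) := by
  have key : ∀ m, Nonempty ((∀ i : {i // n i = m}, ZMod (n i.1)) ≃ₜ+
      ∀ i : {i // n' i = m}, ZMod (n' i.1)) := by
    intro m
    suffices h : Nonempty (({i // n i = m} → ZMod m) ≃ₜ+ ({i // n' i = m} → ZMod m)) by
      let e := piZModFibreEquiv n m
      let e' := piZModFibreEquiv n' m
      obtain ⟨f⟩ := h
      exact ⟨(e.trans f).trans e'.symm⟩
    by_cases hm1 : m = 1
    · subst hm1
      exact ⟨{ toFun := 0, invFun := 0, left_inv := fun _ => Subsingleton.elim _ _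
               right_inv := fun _ => Subsingleton.elim _ _
               map_add' := fun _ _ => Subsingleton.elim _ _
               continuous_toFun := continuous_const
               continuous_invFun := continuous_const }⟩
    · suffices h : Nonempty ({i // n i = m} ≃ {i // n' i = m}) from
        h.map fun e => ContinuousAddEquiv.arrowCongrLeft e _
      by_cases hm : IsPrimePow m
      · have := hinf m hm
        have := hinf' m hm
        obtain ⟨a⟩ := nonempty_denumerable {i // n i = m}
        obtain ⟨b⟩ := nonempty_denumerable {i // n' i = m}
        exact ⟨Denumerable.equiv₂ _ _⟩
      · have : IsEmpty {i // n i = m} := ⟨fun ⟨i, hi⟩ => by subst hi; exact hm (hn i hm1)⟩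
        have : IsEmpty {i // n' i = m} := ⟨fun ⟨i, hi⟩ => by subst hi; exact hm (hn' i hm1)⟩
        exact ⟨Equiv.equivOfIsEmpty _ _⟩
  exact ⟨((ContinuousAddEquiv.piFiberwise n _).trans (.piCongrRight fun m => (key m).some)).trans
    (ContinuousAddEquiv.piFiberwise n' _).symm⟩

end

/-! ### The integral adeles -/

section

open Filter Topology IsDedekindDomain NumberField NumberTheorySymbols

instance fact_prime_primes (p : Nat.Primes) : Fact (p : ℕ).Prime := ⟨p.2⟩

section IntegralAdeles

variable {K : Type*} [Field K] [NumberField K]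

theorem SemilocalIntegers.exists_isPadicOrder (h2 : Module.finrank ℚ K = 2) (p : Nat.Primes) :
    ∃ b : Fin 2 → SemilocalIntegers K p, IsPadicOrder (p : ℕ) b :=
  ⟨_, SemilocalIntegers.isPadicOrder
    (Module.finBasisOfFinrankEq ℤ (𝓞 K) ((RingOfIntegers.rank K).trans h2)) p⟩

theorem SemilocalIntegers.nonempty_continuousAddEquiv (h2 : Module.finrank ℚ K = 2)
    (p : Nat.Primes) : Nonempty ((Fin 2 → ℤ_[p]) ≃ₜ+ SemilocalIntegers K p) := by
  obtain ⟨b, hb⟩ := SemilocalIntegers.exists_isPadicOrder h2 p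
  exact hb.nonempty_continuousAddEquiv

/-- The unit group of the semilocal ring at `p` is `ℤ_p²` times finitely many cyclic groups of prime
power order. If all units have order dividing `p - 1` modulo `p`, then the exact power of any prime
`ℓ ∣ p - 1` is one of these orders. -/
theorem SemilocalIntegers.exists_units_equiv (h2 : Module.finrank ℚ K = 2) (p : Nat.Primes) :
    ∃ (J : Type) (_ : Finite J) (q a : J → ℕ), (∀ j, (q j).Prime) ∧
      Nonempty (Additive (SemilocalIntegers K p)ˣ ≃ₜ+
        (Fin 2 → ℤ_[p]) × ∀ j, ZMod (q j ^ a j)) ∧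
      ((∀ u : (SemilocalIntegers K p)ˣ,
          ((p : ℕ) : SemilocalIntegers K p) ∣ (u : SemilocalIntegers K p) ^ ((p : ℕ) - 1) - 1) →
        ∀ ℓ k : ℕ, ℓ.Prime → ℓ ≠ (p : ℕ) → ℓ ^ (k + 1) ∣ (p : ℕ) - 1 → ¬ ℓ ^ (k + 2) ∣ (p : ℕ) - 1 →
          ∃ j, q j ^ a j = ℓ ^ (k + 1)) := by
  obtain ⟨b, hb⟩ := SemilocalIntegers.exists_isPadicOrder h2 p
  obtain ⟨φ⟩ := hb.nonempty_continuousAddEquiv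
  -- Compactness is transported from the additive description.
  have : CompactSpace (SemilocalIntegers K p) := φ.toHomeomorph.compactSpace
  obtain ⟨F, _, ⟨e⟩⟩ := hb.nonempty_units_equiv
  obtain ⟨J, _, q, hq, a, ⟨d⟩⟩ := AddCommGroup.equiv_directSum_zmod_of_finite F
  let d' : F ≃+ ∀ j, ZMod (q j ^ a j) := d.trans (DirectSum.addEquivProd _)
  have := t2Space_additive_units (R := SemilocalIntegers K p)
  refine ⟨J, inferInstance, q, a, hq,
    ⟨e.trans (.prodCongr (.refl _) d'.toContinuousAddEquivOfDiscrete)⟩, ?_⟩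
  intro hsplit ℓ k hℓ hℓp h1 h3
  exact hb.exists_primePow_eq hsplit e q a hq d' hℓ hℓp h1 h3

variable (K) in
/-- The ring of integral finite adeles, the product of the local integers at all finite places. -/
abbrev IntegralAdeles : Type _ :=
  ∀ v : HeightOneSpectrum (𝓞 K), v.adicCompletionIntegers K

/-- The additive group of the integral adeles does not depend on the quadratic field. -/
theorem IntegralAdeles.nonempty_continuousAddEquiv (h2 : Module.finrank ℚ K = 2) :
    Nonempty (IntegralAdeles K ≃ₜ+ ∀ p : Nat.Primes, Fin 2 → ℤ_[p]) :=
  ⟨(ContinuousAddEquiv.piFiberwise residueChar _).trans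
    (.piCongrRight fun p => (SemilocalIntegers.nonempty_continuousAddEquiv h2 p).some.symm)⟩

theorem IntegralAdeles.nonempty_units_fibre_equiv : Nonempty (Additive (IntegralAdeles K)ˣ ≃ₜ+
    ∀ p, Additive (SemilocalIntegers K p)ˣ) := by
  have e : (IntegralAdeles K)ˣ ≃ₜ* ∀ p, (SemilocalIntegers K p)ˣ :=
    (ContinuousMulEquiv.piUnits.trans (ContinuousMulEquiv.piFiberwise residueChar _)).trans
      (.piCongrRight fun p => ContinuousMulEquiv.piUnits.symm)
  exact ⟨e.toAdditive.trans (ContinuousMulEquiv.additivePi _)⟩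

/-- The integral ideles are the product of a group independent of the field and countably many
finite cyclic groups, where every prime power occurs infinitely often as an order. -/
theorem IntegralAdeles.exists_units_equiv (h2 : Module.finrank ℚ K = 2) {d : ℤ}
    (hd : Squarefree d) {q : ℕ} (hq : q.Prime) (hq2 : q ≠ 2) (hqd : (q : ℤ) ∣ d) {δ : 𝓞 K}
    (hδ : IsSqrtGenerator d (δ : K)) :
    ∃ (I : Type) (_ : Countable I) (n : I → ℕ), (∀ i, n i ≠ 1 → IsPrimePow (n i)) ∧
      (∀ m, IsPrimePow m → Infinite {i // n i = m}) ∧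
      Nonempty (Additive (IntegralAdeles K)ˣ ≃ₜ+
        (∀ p : Nat.Primes, Fin 2 → ℤ_[p]) × ∀ i, ZMod (n i)) := by
  choose J hJ Q a hQ e hsplit using SemilocalIntegers.exists_units_equiv h2
  obtain ⟨N, hN⟩ := hδ.exists_forall_dvd_pow_sub_self
  refine ⟨Σ p, J p, inferInstance, fun i => Q i.1 i.2 ^ a i.1 i.2, ?_, ?_, ?_⟩
  · intro i hi
    refine (hQ i.1 i.2).isPrimePow.pow fun h => hi ?_
    change Q i.1 i.2 ^ a i.1 i.2 = 1
    rw [h, pow_zero]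
  · intro m hm
    obtain ⟨ℓ, k, hℓ, hk, rfl⟩ := (isPrimePow_nat_iff m).1 hm
    obtain ⟨k, rfl⟩ := Nat.exists_eq_succ_of_ne_zero hk.ne'
    -- The primes below the factors of order `m` are unbounded.
    refine Set.infinite_coe_iff.2 (Set.Infinite.of_image (fun i : Σ p, J p => (i.1 : ℕ))
      (Set.infinite_of_forall_exists_gt fun B => ?_))
    obtain ⟨p, hp, hpp, hJp, h1, h3⟩ :=
      exists_prime_jacobiSym_eq_one hd hq hq2 hqd hℓ k (max (max N B) ℓ)
    simp only [max_lt_iff, gt_iff_lt] at hp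
    obtain ⟨j, hj⟩ := hsplit ⟨p, hpp⟩
      (SemilocalIntegers.dvd_unit_pow_sub_one (hN p hp.1.1 hpp hJp)) ℓ k hℓ hp.2.ne h1 h3
    exact ⟨p, ⟨⟨⟨p, hpp⟩, j⟩, hj, rfl⟩, hp.1.2⟩
  · obtain ⟨f⟩ := IntegralAdeles.nonempty_units_fibre_equiv (K := K)
    exact ⟨((f.trans (.piCongrRight fun p => (e p).some)).trans (.piProd _ _)).trans
      (.prodCongr (.refl _)
        (ContinuousAddEquiv.piSigmaCurry fun p j => ZMod (Q p j ^ a p j)).symm)⟩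

end IntegralAdeles

end

/-! ### Extending isomorphisms from an open subgroup -/

section

open Filter Topology

/-- A homomorphism is continuous if its restriction to an open subgroup is. -/
theorem AddMonoidHom.continuous_of_comp_isOpenEmbedding {U A B : Type*} [AddGroup U] [AddGroup A]
    [AddGroup B] [TopologicalSpace U] [TopologicalSpace A] [TopologicalSpace B]
    [IsTopologicalAddGroup A] [IsTopologicalAddGroup B] {i : U →+ A} (hi : IsOpenEmbedding i)
    (T : A →+ B) (h : Continuous fun u => T (i u)) : Continuous T := by
  refine continuous_of_continuousAt_zero T ?_
  rw [ContinuousAt, ← map_zero i, ← hi.map_nhds_eq, tendsto_map'_iff]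
  exact h.tendsto 0

theorem AddMonoidHom.isLocalizedModule_toIntLinearMap {U A : Type*} [AddCommGroup U]
    [AddCommGroup A] {i : U →+ A} (hi : Function.Injective i)
    (hA : ∀ n : ℤ, n ≠ 0 → Function.Bijective fun a : A => n • a)
    (hU : ∀ a : A, ∃ n : ℤ, n ≠ 0 ∧ ∃ u, n • a = i u) :
    IsLocalizedModule (nonZeroDivisors ℤ) i.toIntLinearMap := by
  refine ⟨fun n => (Module.End.isUnit_iff _).2 (hA n (nonZeroDivisors.ne_zero n.2)), fun a => ?_,
    fun {x y} h => ⟨1, by rw [hi h]⟩⟩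
  obtain ⟨n, hn, u, hu⟩ := hU a
  exact ⟨(u, ⟨n, mem_nonZeroDivisors_of_ne_zero hn⟩), hu⟩

/-- An isomorphism between open subgroups `U` of `A` and `U'` of `A'` extends to `A ≃ A'` when both
groups are the localizations of these subgroups at the nonzero integers. -/
theorem nonempty_continuousAddEquiv_of_isLocalizedModule {U U' A A' : Type*} [AddCommGroup U]
    [AddCommGroup U'] [AddCommGroup A] [AddCommGroup A'] [TopologicalSpace U] [TopologicalSpace U']
    [TopologicalSpace A] [TopologicalSpace A'] [IsTopologicalAddGroup A] [IsTopologicalAddGroup A']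
    {i : U →+ A} {i' : U' →+ A'} (hi : IsOpenEmbedding i) (hi' : IsOpenEmbedding i')
    [IsLocalizedModule (nonZeroDivisors ℤ) i.toIntLinearMap]
    [IsLocalizedModule (nonZeroDivisors ℤ) i'.toIntLinearMap] (e : U ≃ₜ+ U') :
    Nonempty (A ≃ₜ+ A') := by
  let e' : U ≃ₗ[ℤ] U' := e.toAddEquiv.toIntLinearEquiv
  let T := IsLocalizedModule.linearEquiv (nonZeroDivisors ℤ) i.toIntLinearMap
    (i'.toIntLinearMap ∘ₗ e'.toLinearMap)
  have hT : ∀ u, T (i u) = i' (e u) := fun u =>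
    IsLocalizedModule.linearEquiv_apply (nonZeroDivisors ℤ) i.toIntLinearMap
      (i'.toIntLinearMap ∘ₗ e'.toLinearMap) u
  have hT' : ∀ u, T.symm (i' u) = i (e.symm u) := fun u => by
    rw [LinearEquiv.symm_apply_eq, hT, e.apply_symm_apply]
  refine ⟨{ T.toAddEquiv with
    continuous_toFun := ?_
    continuous_invFun := ?_ }⟩
  · refine AddMonoidHom.continuous_of_comp_isOpenEmbedding hi T.toAddEquiv.toAddMonoidHom ?_
    exact (hi'.continuous.comp e.continuous_toFun).congr fun u => (hT u).symm
  · refine AddMonoidHom.continuous_of_comp_isOpenEmbedding hi' T.symm.toAddEquiv.toAddMonoidHom ?_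
    exact (hi.continuous.comp e.continuous_invFun).congr fun u => (hT' u).symm

/-- If an open subgroup `H` of `G` is the kernel of a split surjection onto a discrete group `D`,
then `G` is `H × D`, as a topological group. -/
theorem nonempty_continuousAddEquiv_prod_of_section {H G D : Type*} [AddCommGroup H]
    [AddCommGroup G] [AddCommGroup D] [TopologicalSpace H] [TopologicalSpace G]
    [IsTopologicalAddGroup G] [IsTopologicalAddGroup H] [TopologicalSpace D] [DiscreteTopology D]
    {i : H →+ G} (hi : IsOpenEmbedding i) (π : G →+ D) (hπ : π.ker = i.range) (s : D →+ G)
    (hs : ∀ d, π (s d) = d) : Nonempty (G ≃ₜ+ H × D) := by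
  have hπi : ∀ h, π (i h) = 0 := fun h => by
    have : i h ∈ π.ker := hπ ▸ ⟨h, rfl⟩
    exact this
  let f : H × D →+ G := i.coprod s
  have hf : ∀ x, f x = i x.1 + s x.2 := fun x => AddMonoidHom.coprod_apply ..
  have hbij : Function.Bijective f := by
    refine ⟨(injective_iff_map_eq_zero f).2 fun ⟨h, d⟩ hx => ?_, fun g => ?_⟩
    · rw [hf] at hx
      have h1 := congrArg π hx
      simp only [map_add, hπi, hs, map_zero, zero_add] at h1
      subst h1
      rw [map_zero, add_zero, map_eq_zero_iff i hi.injective] at hx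
      exact Prod.ext hx rfl
    · have : g - s (π g) ∈ i.range := by rw [← hπ, AddMonoidHom.mem_ker, map_sub, hs, sub_self]
      obtain ⟨h, hh⟩ := this
      exact ⟨(h, π g), by rw [hf, hh, sub_add_cancel]⟩
  let F := AddEquiv.ofBijective f hbij
  refine ⟨{ F.symm with
    continuous_toFun := ?_
    continuous_invFun := ?_ }⟩
  · refine AddMonoidHom.continuous_of_comp_isOpenEmbedding hi F.symm.toAddMonoidHom ?_
    refine (continuous_id.prodMk (continuous_const (y := (0 : D)))).congr fun h => ?_
    refine (F.symm_apply_eq.2 ?_).symm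
    exact (by rw [hf, map_zero, add_zero] : i h = f (h, 0))
  · change Continuous fun x => f x
    simp_rw [hf]
    exact (hi.continuous.comp continuous_fst).add
      (continuous_of_discreteTopology.comp continuous_snd)

theorem isOpenEmbedding_units_map {M N : Type*} [Monoid M] [Monoid N] [TopologicalSpace M]
    [TopologicalSpace N] {f : M →* N} (hf : IsOpenEmbedding f) : IsOpenEmbedding (Units.map f) := by
  have hcont : Continuous (Units.map f) := hf.continuous.units_map f
  refine ⟨?_, ?_⟩
  · refine IsEmbedding.of_comp hcont Units.continuous_embedProduct ?_
    have h1 : IsEmbedding (Prod.map f (MulOpposite.op ∘ f ∘ MulOpposite.unop)) :=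
      hf.isEmbedding.prodMap ((MulOpposite.opHomeomorph.isEmbedding.comp hf.isEmbedding).comp
        MulOpposite.opHomeomorph.symm.isEmbedding)
    exact h1.comp Units.isEmbedding_embedProduct
  · have h1 : Set.range (Units.map f) =
        {u : Nˣ | (u : N) ∈ Set.range f} ∩ {u : Nˣ | ((u⁻¹ : Nˣ) : N) ∈ Set.range f} := by
      ext u
      constructor
      · rintro ⟨v, rfl⟩
        exact ⟨⟨v, rfl⟩, ⟨_, rfl⟩⟩
      · rintro ⟨⟨a, ha⟩, ⟨b, hb⟩⟩
        refine ⟨⟨a, b, hf.injective ?_, hf.injective ?_⟩, Units.ext ha⟩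
        · rw [map_mul, ha, hb, map_one, Units.mul_inv]
        · rw [map_mul, ha, hb, map_one, Units.inv_mul]
    rw [h1]
    exact (hf.isOpen_range.preimage Units.continuous_val).inter
      (hf.isOpen_range.preimage Units.continuous_coe_inv)

end

/-! ### The finite adeles -/

section

open Filter Topology IsDedekindDomain NumberField

section FiniteAdeles

open HeightOneSpectrum

variable {K : Type*} [Field K] [NumberField K]

instance countable_heightOneSpectrum : Countable (HeightOneSpectrum (𝓞 K)) :=
  (Equiv.sigmaFiberEquiv (residueChar (K := K))).countable_iff.1 inferInstance

instance infinite_heightOneSpectrum : Infinite (HeightOneSpectrum (𝓞 K)) := by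
  refine Infinite.of_surjective (residueChar (K := K)) fun p => ?_
  have hp : ¬ IsUnit ((p : ℕ) : 𝓞 K) := fun h => by
    have h1 := (h.map (Algebra.norm ℤ))
    rw [← map_natCast (algebraMap ℤ (𝓞 K)), Algebra.norm_algebraMap, isUnit_pow_iff
      (Module.finrank_pos.ne'), Int.isUnit_iff_natAbs_eq] at h1
    exact p.2.one_lt.ne' (by simpa using h1)
  obtain ⟨M, hM, hpM⟩ := exists_max_ideal_of_mem_nonunits hp
  refine ⟨⟨M, hM.isPrime, fun h => ?_⟩, residueChar_eq_iff.2 hpM⟩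
  rw [h, Ideal.mem_bot] at hpM
  exact p.2.ne_zero (by exact_mod_cast hpM)

variable (K) in
/-- The inclusion of the integral adeles into the finite adeles. -/
noncomputable def integralAdelesHom : IntegralAdeles K →+* FiniteAdeles K where
  toFun x := ⟨fun v => x v, .of_forall fun v => (x v).2⟩
  map_one' := rfl
  map_mul' _ _ := rfl
  map_zero' := rfl
  map_add' _ _ := rfl

theorem isOpenEmbedding_integralAdelesHom : IsOpenEmbedding (integralAdelesHom K) :=
  RestrictedProduct.isOpenEmbedding_structureMap
    (R := fun v : HeightOneSpectrum (𝓞 K) => v.adicCompletion K)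
    (A := fun v => (v.adicCompletionIntegers K : Set (v.adicCompletion K)))
    (fun _ => Valued.isOpen_valuationSubring _)

theorem exists_integralAdelesHom_eq {x : FiniteAdeles K}
    (hx : ∀ v, x v ∈ v.adicCompletionIntegers K) : ∃ y, integralAdelesHom K y = x :=
  ⟨fun v => ⟨x v, hx v⟩, rfl⟩

theorem FiniteAdeles.coe_mul (x y : FiniteAdeles K) (v : HeightOneSpectrum (𝓞 K)) :
    (x * y) v = x v * y v := rfl

theorem FiniteAdeles.coe_one (v : HeightOneSpectrum (𝓞 K)) : (1 : FiniteAdeles K) v = 1 := rfl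

theorem FiniteAdeles.coe_intCast (n : ℤ) (v : HeightOneSpectrum (𝓞 K)) :
    (n : FiniteAdeles K) v = n := rfl

/-- Evaluation of finite adeles at a place. -/
noncomputable def FiniteAdeles.evalHom (v : HeightOneSpectrum (𝓞 K)) :
    FiniteAdeles K →+* v.adicCompletion K where
  toFun x := x v
  map_one' := rfl
  map_mul' _ _ := rfl
  map_zero' := rfl
  map_add' _ _ := rfl

/-- A local denominator can be chosen in `ℤ`, as the norm of a denominator in `𝓞_K`. -/
theorem exists_int_mul_mem_adicCompletionIntegers (v : HeightOneSpectrum (𝓞 K))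
    (a : v.adicCompletion K) : ∃ n : ℤ, n ≠ 0 ∧ n * a ∈ v.adicCompletionIntegers K := by
  obtain ⟨b, hb, hab⟩ := adicCompletion.mul_nonZeroDivisor_mem_adicCompletionIntegers v a
  have hb0 : b ≠ 0 := nonZeroDivisors.ne_zero hb
  obtain ⟨c, hc⟩ := Ideal.mem_span_singleton.1 (Ideal.absNorm_mem (Ideal.span {b}))
  refine ⟨(Ideal.absNorm (Ideal.span {b}) : ℕ), ?_, ?_⟩
  · rw [Int.natCast_ne_zero, Ne, Ideal.absNorm_eq_zero_iff, Ideal.span_singleton_eq_bot]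
    exact hb0
  · have h1 : (((Ideal.absNorm (Ideal.span {b}) : ℕ) : ℤ) : v.adicCompletion K) * a =
        (a * algebraMap (𝓞 K) (v.adicCompletion K) b) *
          algebraMap (𝓞 K) (v.adicCompletion K) c := by
      rw [mul_assoc, ← map_mul, ← hc, map_natCast, Int.cast_natCast, mul_comm]
    rw [h1]
    exact mul_mem hab (algebraMap (𝓞 K) (v.adicCompletionIntegers K) c).2

theorem FiniteAdeles.exists_zsmul_eq (a : FiniteAdeles K) :
    ∃ n : ℤ, n ≠ 0 ∧ ∃ u, n • a = integralAdelesHom K u := by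
  classical
  have hfin : {v : HeightOneSpectrum (𝓞 K) | a v ∉ v.adicCompletionIntegers K}.Finite := a.2
  choose n hn0 hn using fun v => exists_int_mul_mem_adicCompletionIntegers v (a v)
  refine ⟨∏ v ∈ hfin.toFinset, n v, Finset.prod_ne_zero_iff.2 fun v _ => hn0 v, ?_⟩
  obtain ⟨u, hu⟩ := exists_integralAdelesHom_eq
    (x := ((∏ v ∈ hfin.toFinset, n v : ℤ) : FiniteAdeles K) * a) fun v => by
      rw [FiniteAdeles.coe_mul, FiniteAdeles.coe_intCast]
      by_cases hv : a v ∈ v.adicCompletionIntegers K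
      · exact mul_mem (intCast_mem _ _) hv
      · rw [← Finset.prod_erase_mul _ _ (hfin.mem_toFinset.2 hv), Int.cast_mul, mul_assoc]
        exact mul_mem (intCast_mem _ _) (hn v)
  exact ⟨u, by rw [hu, zsmul_eq_mul]⟩

theorem FiniteAdeles.bijective_zsmul {n : ℤ} (hn : n ≠ 0) :
    Function.Bijective fun a : FiniteAdeles K => n • a := by
  have h1 : (n : FiniteAdeles K) = algebraMap K _ n := (map_intCast _ n).symm
  have h2 : IsUnit (n : FiniteAdeles K) := by
    rw [h1]
    exact (IsUnit.mk0 (n : K) (by exact_mod_cast hn)).map _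
  simp_rw [zsmul_eq_mul]
  exact IsUnit.isUnit_iff_mulLeft_bijective.1 h2

instance : IsLocalizedModule (nonZeroDivisors ℤ)
    (integralAdelesHom K).toAddMonoidHom.toIntLinearMap :=
  AddMonoidHom.isLocalizedModule_toIntLinearMap isOpenEmbedding_integralAdelesHom.injective
    (fun _ hn => FiniteAdeles.bijective_zsmul hn) FiniteAdeles.exists_zsmul_eq

theorem FiniteAdeles.nonempty_continuousAddEquiv {L : Type*} [Field L] [NumberField L]
    (hK : Module.finrank ℚ K = 2) (hL : Module.finrank ℚ L = 2) :
    Nonempty (FiniteAdeles K ≃ₜ+ FiniteAdeles L) := by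
  obtain ⟨e⟩ := IntegralAdeles.nonempty_continuousAddEquiv hK
  obtain ⟨f⟩ := IntegralAdeles.nonempty_continuousAddEquiv hL
  exact nonempty_continuousAddEquiv_of_isLocalizedModule
    (i := (integralAdelesHom K).toAddMonoidHom) (i' := (integralAdelesHom L).toAddMonoidHom)
    isOpenEmbedding_integralAdelesHom isOpenEmbedding_integralAdelesHom (e.trans f.symm)

theorem FiniteAdeles.unit_apply_ne_zero (u : (FiniteAdeles K)ˣ) (v : HeightOneSpectrum (𝓞 K)) :
    (u : FiniteAdeles K) v ≠ 0 :=
  (u.isUnit.map (FiniteAdeles.evalHom v)).ne_zero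

/-- The orders of a finite idele at all finite places, with the sign convention that makes a
uniformizer have order `-1`. -/
noncomputable def ideleOrd : Additive (FiniteAdeles K)ˣ →+ (HeightOneSpectrum (𝓞 K) →₀ ℤ) where
  toFun u := Finsupp.ofSupportFinite
    (fun v => WithZero.log (Valued.v ((u.toMul : FiniteAdeles K) v))) <| by
      refine ((FiniteAdeleRing.isUnit_iff.1 u.toMul.isUnit).2 : _).subset fun v hv h => hv ?_
      exact (congrArg WithZero.log h).trans WithZero.log_one
  map_zero' := by
    ext v
    change WithZero.log (Valued.v (1 : v.adicCompletion K)) = 0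
    rw [map_one, WithZero.log_one]
  map_add' x y := by
    ext v
    change WithZero.log (Valued.v ((x.toMul : FiniteAdeles K) v * (y.toMul : FiniteAdeles K) v)) =
      WithZero.log (Valued.v ((x.toMul : FiniteAdeles K) v)) +
        WithZero.log (Valued.v ((y.toMul : FiniteAdeles K) v))
    rw [map_mul, WithZero.log_mul]
    · exact (Valuation.ne_zero_iff _).2 (FiniteAdeles.unit_apply_ne_zero _ v)
    · exact (Valuation.ne_zero_iff _).2 (FiniteAdeles.unit_apply_ne_zero _ v)

theorem ideleOrd_apply (u : Additive (FiniteAdeles K)ˣ) (v : HeightOneSpectrum (𝓞 K)) :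
    ideleOrd u v = WithZero.log (Valued.v ((u.toMul : FiniteAdeles K) v)) := rfl

theorem ker_ideleOrd : (ideleOrd (K := K)).ker =
    (Units.map (integralAdelesHom K : IntegralAdeles K →* FiniteAdeles K)).toAdditive.range := by
  ext u
  constructor
  · intro hu
    have h1 : ∀ v, Valued.v ((u.toMul : FiniteAdeles K) v) = 1 := fun v => by
      have h2 : WithZero.log (Valued.v ((u.toMul : FiniteAdeles K) v)) = 0 :=
        DFunLike.congr_fun hu v
      rw [← WithZero.exp_log ((Valuation.ne_zero_iff Valued.v).2
        (FiniteAdeles.unit_apply_ne_zero u.toMul v)), h2, WithZero.exp_zero]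
    have h3 : ∀ v, Valued.v (((u.toMul⁻¹ : (FiniteAdeles K)ˣ) : FiniteAdeles K) v) = 1 := by
      intro v
      have h4 : (u.toMul : FiniteAdeles K) v *
          ((u.toMul⁻¹ : (FiniteAdeles K)ˣ) : FiniteAdeles K) v = 1 := by
        rw [← FiniteAdeles.coe_mul, Units.mul_inv, FiniteAdeles.coe_one]
      have h5 := congrArg Valued.v h4
      rwa [map_mul, h1, one_mul, map_one] at h5
    obtain ⟨x, hx⟩ := exists_integralAdelesHom_eq (x := (u.toMul : FiniteAdeles K))
      fun v => (mem_adicCompletionIntegers ..).2 (h1 v).le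
    obtain ⟨y, hy⟩ := exists_integralAdelesHom_eq
      (x := ((u.toMul⁻¹ : (FiniteAdeles K)ˣ) : FiniteAdeles K))
      fun v => (mem_adicCompletionIntegers ..).2 (h3 v).le
    have hinj := (isOpenEmbedding_integralAdelesHom (K := K)).injective
    have hxy : x * y = 1 := hinj (by rw [map_mul, hx, hy, map_one, Units.mul_inv])
    exact ⟨Additive.ofMul ⟨x, y, hxy, by rw [mul_comm, hxy]⟩, Units.ext (v := u.toMul) hx⟩
  · rintro ⟨w, rfl⟩
    ext v
    have hw : Valued.v (((w.toMul : IntegralAdeles K) v : v.adicCompletion K)) = 1 :=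
      adicCompletionIntegers.isUnit_iff_valued_eq_one.1
        (w.toMul.isUnit.map (Pi.evalRingHom
          (fun v : HeightOneSpectrum (𝓞 K) => ↥(v.adicCompletionIntegers K)) v))
    change WithZero.log (Valued.v (((w.toMul : IntegralAdeles K) v : v.adicCompletion K))) = 0
    rw [hw, WithZero.log_one]

/-- There is an idele of order one at a given place and trivial elsewhere. -/
theorem exists_ideleOrd_eq_single (v : HeightOneSpectrum (𝓞 K)) :
    ∃ u : Additive (FiniteAdeles K)ˣ, ideleOrd u = Finsupp.single v 1 := by
  classical
  obtain ⟨ϖ, hϖ⟩ := v.valuation_exists_uniformizer K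
  have hϖ0 : ((ϖ : K) : v.adicCompletion K) ≠ 0 := fun h => by
    have h1 := valuedAdicCompletion_eq_valuation' v ϖ
    rw [h, map_zero, hϖ] at h1
    exact WithZero.exp_ne_zero h1.symm
  let x : v.adicCompletion K → FiniteAdeles K := fun a =>
    RestrictedProduct.mulSingle (fun v : HeightOneSpectrum (𝓞 K) => v.adicCompletionIntegers K) v a
  have hx : ∀ a b, a * b = 1 → x a * x b = 1 := fun a b hab => by
    have h1 := RestrictedProduct.mulSingle_mul
      (fun v : HeightOneSpectrum (𝓞 K) => v.adicCompletionIntegers K) v a b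
    rw [hab, RestrictedProduct.mulSingle_one] at h1
    exact h1.symm
  refine ⟨Additive.ofMul ⟨x (ϖ : v.adicCompletion K)⁻¹, x ϖ, hx _ _ (inv_mul_cancel₀ hϖ0),
    hx _ _ (mul_inv_cancel₀ hϖ0)⟩, ?_⟩
  ext w
  rw [ideleOrd_apply]
  change WithZero.log (Valued.v (Pi.mulSingle (M := fun w => w.adicCompletion K) v
    ((ϖ : K) : v.adicCompletion K)⁻¹ w)) = _
  rcases eq_or_ne w v with rfl | hw
  · rw [Pi.mulSingle_eq_same, Finsupp.single_eq_same, map_inv₀, valuedAdicCompletion_eq_valuation',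
      hϖ, WithZero.log_inv, WithZero.log_exp, neg_neg]
  · rw [Pi.mulSingle_eq_of_ne hw, Finsupp.single_eq_of_ne hw, map_one, WithZero.log_one]

/-- The finite ideles are the product of the integral ideles and a free abelian group with a basis
indexed by the finite places. -/
theorem FiniteAdeles.nonempty_units_equiv [TopologicalSpace (HeightOneSpectrum (𝓞 K) →₀ ℤ)]
    [DiscreteTopology (HeightOneSpectrum (𝓞 K) →₀ ℤ)] :
    Nonempty (Additive (FiniteAdeles K)ˣ ≃ₜ+
      Additive (IntegralAdeles K)ˣ × (HeightOneSpectrum (𝓞 K) →₀ ℤ)) := by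
  choose u hu using exists_ideleOrd_eq_single (K := K)
  refine nonempty_continuousAddEquiv_prod_of_section
    (i := (Units.map (integralAdelesHom K : IntegralAdeles K →* FiniteAdeles K)).toAdditive)
    (isOpenEmbedding_units_map isOpenEmbedding_integralAdelesHom) ideleOrd ker_ideleOrd
    (Finsupp.liftAddHom fun v => zmultiplesHom _ (u v)) fun d => ?_
  suffices h : (ideleOrd (K := K)).comp (Finsupp.liftAddHom fun v => zmultiplesHom _ (u v)) =
      AddMonoidHom.id _ from DFunLike.congr_fun h d
  refine Finsupp.addHom_ext fun v n => ?_
  simp [hu]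

end FiniteAdeles

end

/-! ### Imaginary quadratic fields -/

section

open Filter Topology IsDedekindDomain NumberField NumberTheorySymbols

section Main

open HeightOneSpectrum

variable {K L : Type*} [Field K] [NumberField K] [Field L] [NumberField L]

/-- An imaginary quadratic field is generated by the square root of a negative squarefree
integer. -/
theorem IsImaginaryQuadratic.exists_isSqrtGenerator (hK : IsImaginaryQuadratic K) :
    ∃ (d : ℤ) (δ : 𝓞 K), Squarefree d ∧ d < 0 ∧ IsSqrtGenerator d (δ : K) := by
  have := hK.2
  obtain ⟨d, δ, hd, hδ⟩ := exists_isSqrtGenerator_of_finrank_eq_two hK.1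
  have hint : IsIntegral ℤ δ := by
    refine IsIntegral.of_pow two_pos ?_
    rw [hδ.sq_eq]
    exact isIntegral_algebraMap (R := ℤ) (x := d)
  exact ⟨d, ⟨δ, hint⟩, hd, hδ.neg, hδ⟩

theorem natAbs_eq_one_or_two_of_squarefree {d : ℤ} (hd : Squarefree d)
    (h : ∀ q : ℕ, q.Prime → (q : ℤ) ∣ d → q = 2) : d.natAbs = 1 ∨ d.natAbs = 2 := by
  have h1 := Nat.eq_prime_pow_of_unique_prime_dvd (Int.natAbs_ne_zero.2 hd.ne_zero)
    fun {q} hq hqd => h q hq (Int.natCast_dvd.2 hqd)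
  have h2 : Squarefree (2 ^ d.natAbs.primeFactorsList.length) :=
    h1 ▸ Int.squarefree_natAbs.2 hd
  rw [h1]
  generalize d.natAbs.primeFactorsList.length = k at h2
  rcases k with _ | _ | k
  · exact Or.inl rfl
  · exact Or.inr rfl
  · exact absurd (Nat.isUnit_iff.1 (h2 2 ⟨2 ^ k, by ring⟩)) (by norm_num)

/-- Apart from `ℚ(i)` and `ℚ(√-2)`, an imaginary quadratic field is generated by the square root of
a squarefree integer with an odd prime factor. -/
theorem IsSqrtGenerator.exists_odd_prime_dvd {d : ℤ} {δ : K} (hδ : IsSqrtGenerator d δ)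
    (hd : Squarefree d) (hneg : d < 0) (h₁ : IsEmpty (K ≃+* QI))
    (h₂ : IsEmpty (K ≃+* QSqrtNegTwo)) : ∃ q : ℕ, q.Prime ∧ q ≠ 2 ∧ (q : ℤ) ∣ d := by
  by_contra! h
  rcases natAbs_eq_one_or_two_of_squarefree hd fun q hq hqd => by
    by_contra hq2
    exact h q hq hq2 hqd with h3 | h3
  · have hd1 : d = -1 := by omega
    exact (hδ.nonempty_ringEquiv (isSqrtGenerator_adjoin (by simp [hd1])) hneg).elim h₁.false
  · have hd2 : d = -2 := by omega
    have hsq : ((Real.sqrt 2 : ℂ) * Complex.I) ^ 2 = (d : ℂ) := by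
      rw [mul_pow, Complex.I_sq, ← Complex.ofReal_pow, Real.sq_sqrt zero_le_two, hd2]
      norm_num
    exact (hδ.nonempty_ringEquiv (isSqrtGenerator_adjoin hsq) hneg).elim h₂.false

/-- The finite idele groups are isomorphic, because all three factors agree: the `p`-adic parts, the
products of finite cyclic groups, and the free parts indexed by the finite places. -/
theorem FiniteAdeles.nonempty_units_continuousMulEquiv (hK : IsImaginaryQuadratic K)
    (hL : IsImaginaryQuadratic L) (hK₁ : IsEmpty (K ≃+* QI)) (hK₂ : IsEmpty (K ≃+* QSqrtNegTwo))
    (hL₁ : IsEmpty (L ≃+* QI)) (hL₂ : IsEmpty (L ≃+* QSqrtNegTwo)) :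
    Nonempty ((FiniteAdeles K)ˣ ≃ₜ* (FiniteAdeles L)ˣ) := by
  obtain ⟨d, δ, hd, hneg, hδ⟩ := hK.exists_isSqrtGenerator
  obtain ⟨d', δ', hd', hneg', hδ'⟩ := hL.exists_isSqrtGenerator
  obtain ⟨q, hq, hq2, hqd⟩ := hδ.exists_odd_prime_dvd hd hneg hK₁ hK₂
  obtain ⟨q', hq', hq2', hqd'⟩ := hδ'.exists_odd_prime_dvd hd' hneg' hL₁ hL₂
  obtain ⟨I, _, n, hn, hinf, ⟨e⟩⟩ := IntegralAdeles.exists_units_equiv hK.1 hd hq hq2 hqd hδ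
  obtain ⟨I', _, n', hn', hinf', ⟨e'⟩⟩ :=
    IntegralAdeles.exists_units_equiv hL.1 hd' hq' hq2' hqd' hδ'
  obtain ⟨z⟩ := nonempty_pi_zmod_continuousAddEquiv n n' hn hn' hinf hinf'
  let _ : TopologicalSpace (HeightOneSpectrum (𝓞 K) →₀ ℤ) := ⊥
  have : DiscreteTopology (HeightOneSpectrum (𝓞 K) →₀ ℤ) := ⟨rfl⟩
  let _ : TopologicalSpace (HeightOneSpectrum (𝓞 L) →₀ ℤ) := ⊥
  have : DiscreteTopology (HeightOneSpectrum (𝓞 L) →₀ ℤ) := ⟨rfl⟩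
  obtain ⟨_⟩ := nonempty_denumerable (HeightOneSpectrum (𝓞 K))
  obtain ⟨_⟩ := nonempty_denumerable (HeightOneSpectrum (𝓞 L))
  obtain ⟨f⟩ := FiniteAdeles.nonempty_units_equiv (K := K)
  obtain ⟨f'⟩ := FiniteAdeles.nonempty_units_equiv (K := L)
  have g : Additive (IntegralAdeles K)ˣ ≃ₜ+ Additive (IntegralAdeles L)ˣ :=
    (e.trans (.prodCongr (.refl _) z)).trans e'.symm
  have hs : (HeightOneSpectrum (𝓞 K) →₀ ℤ) ≃ₜ+ (HeightOneSpectrum (𝓞 L) →₀ ℤ) :=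
    (Finsupp.domCongr (Denumerable.equiv₂ _ _)).toContinuousAddEquivOfDiscrete
  exact ⟨.ofAdditive ((f.trans (.prodCongr g hs)).trans f'.symm)⟩

/-- The completion of an imaginary quadratic field at its unique infinite place is `ℂ`. -/
theorem IsImaginaryQuadratic.exists_infiniteAdeleRing_equiv (hK : IsImaginaryQuadratic K) :
    ∃ e : InfiniteAdeleRing K ≃+* ℂ, Continuous e ∧ Continuous e.symm := by
  have := hK.2
  have h1 : Fintype.card (InfinitePlace K) = 1 := by
    have h2 := IsTotallyComplex.finrank (K := K)
    have h3 := InfinitePlace.card_eq_nrRealPlaces_add_nrComplexPlaces (K := K)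
    rw [IsTotallyComplex.nrRealPlaces_eq_zero] at h3
    have h4 := hK.1
    omega
  obtain ⟨w, hw⟩ := Fintype.card_eq_one_iff.1 h1
  let _ : Unique (InfinitePlace K) := ⟨⟨w⟩, hw⟩
  have hc := IsTotallyComplex.isComplex (default : InfinitePlace K)
  refine ⟨(RingEquiv.piUnique fun v : InfinitePlace K => v.Completion).trans
    (InfinitePlace.Completion.ringEquivComplexOfIsComplex hc), ?_, ?_⟩
  · exact (InfinitePlace.Completion.isometryEquivComplexOfIsComplex hc).continuous.comp
      (continuous_apply (A := fun v : InfinitePlace K => v.Completion) default)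
  · exact (Homeomorph.piUnique fun v : InfinitePlace K => v.Completion).symm.continuous.comp
      (InfinitePlace.Completion.isometryEquivComplexOfIsComplex hc).symm.continuous

theorem Adeles.nonempty_continuousAddEquiv (hK : IsImaginaryQuadratic K)
    (hL : IsImaginaryQuadratic L) (e : FiniteAdeles K ≃ₜ+ FiniteAdeles L) :
    Nonempty (Adeles K ≃ₜ+ Adeles L) := by
  obtain ⟨f, hf, hf'⟩ := hK.exists_infiniteAdeleRing_equiv
  obtain ⟨g, hg, hg'⟩ := hL.exists_infiniteAdeleRing_equiv
  let F : InfiniteAdeleRing K ≃ₜ+ InfiniteAdeleRing L :=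
    { (f.trans g.symm).toAddEquiv with
      continuous_toFun := hg'.comp hf
      continuous_invFun := hf'.comp hg }
  exact ⟨F.prodCongr e⟩

/-- The units of a product of topological monoids. -/
def ContinuousMulEquiv.prodUnits {M N : Type*} [Monoid M] [Monoid N] [TopologicalSpace M]
    [TopologicalSpace N] : (M × N)ˣ ≃ₜ* Mˣ × Nˣ :=
  { MulEquiv.prodUnits, Homeomorph.prodUnits with }

theorem Adeles.nonempty_units_continuousMulEquiv (hK : IsImaginaryQuadratic K)
    (hL : IsImaginaryQuadratic L) (e : (FiniteAdeles K)ˣ ≃ₜ* (FiniteAdeles L)ˣ) :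
    Nonempty ((Adeles K)ˣ ≃ₜ* (Adeles L)ˣ) := by
  obtain ⟨f, hf, hf'⟩ := hK.exists_infiniteAdeleRing_equiv
  obtain ⟨g, hg, hg'⟩ := hL.exists_infiniteAdeleRing_equiv
  let F : InfiniteAdeleRing K ≃ₜ* InfiniteAdeleRing L :=
    { (f.trans g.symm).toMulEquiv with
      continuous_toFun := hg'.comp hf
      continuous_invFun := hf'.comp hg }
  exact ⟨(ContinuousMulEquiv.prodUnits.trans
    ((Units.mapContinuousMulEquiv F).prodCongr e)).trans ContinuousMulEquiv.prodUnits.symm⟩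

/-- The group `(A, +)^r × (Aˣ, ·)^s` depends only on the topological groups `A` and `Aˣ`. -/
theorem nonempty_addMulPoints_equiv {A B : Type*} [Ring A] [Ring B] [TopologicalSpace A]
    [TopologicalSpace B] (e : Nonempty (A ≃ₜ+ B)) (f : Nonempty (Aˣ ≃ₜ* Bˣ)) (r s : ℕ) :
    Nonempty (AddMulPoints A r s ≃ₜ* AddMulPoints B r s) :=
  ⟨.prodCongr (.piCongrRight fun _ => e.some.toMultiplicative) (.piCongrRight fun _ => f.some)⟩

/-- A square root of `d` in the finite adeles reduces to a square root of `d` in a product of copies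
of `𝔽_p` for every large prime `p` that splits in the field, so that `d` is a square modulo `p`. -/
theorem IsSqrtGenerator.exists_forall_jacobiSym_ne (hL : Module.finrank ℚ L = 2) {d' : ℤ}
    {δ' : 𝓞 L} (hδ' : IsSqrtGenerator d' (δ' : L)) :
    ∃ N, ∀ p > N, p.Prime → J(d' | p) = 1 → ∀ (d : ℤ) (x : FiniteAdeles L), x ^ 2 = d →
      J(d | p) ≠ -1 := by
  obtain ⟨N, hN⟩ := hδ'.exists_forall_dvd_pow_sub_self
  refine ⟨max N 2, fun p hpN hp hJ d x hx hJd => ?_⟩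
  rw [gt_iff_lt, max_lt_iff] at hpN
  have : Fact p.Prime := ⟨hp⟩
  have hint : ∀ v, x v ∈ v.adicCompletionIntegers L := fun v => by
    have h1 : x v ^ 2 = (d : v.adicCompletion L) := by
      rw [sq, ← FiniteAdeles.coe_mul, ← sq, hx, FiniteAdeles.coe_intCast]
    refine (mem_adicCompletionIntegers ..).2 ((pow_le_one_iff two_ne_zero).1 ?_)
    rw [← map_pow, h1]
    exact (mem_adicCompletionIntegers ..).1 (intCast_mem (v.adicCompletionIntegers L) d)
  let P : Nat.Primes := ⟨p, hp⟩
  let r : SemilocalIntegers L P := fun v => ⟨x v.1, hint v.1⟩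
  have hr : r ^ 2 = d := by
    refine funext fun v => Subtype.ext ?_
    change x v.1 ^ 2 = (d : v.1.adicCompletion L)
    rw [sq, ← FiniteAdeles.coe_mul, ← sq, hx, FiniteAdeles.coe_intCast]
  have hdvd : (p : SemilocalIntegers L P) ∣ r ^ p - r :=
    SemilocalIntegers.dvd_pow_sub_self (hN p hpN.1 hp hJ) r
  have hodd : p = 2 * (p / 2) + 1 := by
    rcases hp.eq_two_or_odd' with h | h
    · omega
    · exact (Nat.two_mul_div_two_add_one_of_odd h).symm
  have heuler : (p : SemilocalIntegers L P) ∣ (d : SemilocalIntegers L P) ^ (p / 2) + 1 := by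
    have h1 := map_dvd (Int.castRingHom (SemilocalIntegers L P))
      (intCast_dvd_pow_half_sub_jacobiSym hp d)
    rw [hJd] at h1
    simpa using h1
  -- Euler's criterion gives `r ^ p ≡ -r` modulo `p`, against `r ^ p ≡ r`.
  have hrp : r ^ p = r * (d : SemilocalIntegers L P) ^ (p / 2) := by
    conv_lhs => rw [hodd]
    rw [pow_succ, pow_mul, hr, mul_comm]
  have h2r : (p : SemilocalIntegers L P) ∣ 2 * r := by
    have h1 : 2 * r = r * ((d : SemilocalIntegers L P) ^ (p / 2) + 1) - (r ^ p - r) := by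
      rw [hrp]; ring
    rw [h1]
    exact dvd_sub (heuler.mul_left r) hdvd
  have h4d : (p : SemilocalIntegers L P) ∣ ((4 * d : ℤ) : SemilocalIntegers L P) := by
    have h1 : ((4 * d : ℤ) : SemilocalIntegers L P) = 2 * r * (2 * r) := by
      push_cast
      rw [← hr]
      ring
    rw [h1]
    exact h2r.mul_right _
  obtain ⟨b, hb⟩ := SemilocalIntegers.exists_isPadicOrder hL P
  have hpd : (p : ℤ) ∣ 4 * d := hb.intCast_dvd h4d
  rcases (Nat.prime_iff_prime_int.1 hp).dvd_or_dvd hpd with h | h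
  · have h1 : p ∣ 2 ^ 2 := by exact_mod_cast h
    exact hpN.2.ne' ((Nat.prime_dvd_prime_iff_eq hp Nat.prime_two).1 (hp.dvd_of_dvd_pow h1))
  · have h1 : J(d | p) = 0 := by
      rw [jacobiSym.eq_zero_iff_not_coprime]
      intro hg
      exact hp.one_lt.ne' (Nat.dvd_one.1 (hg ▸ Nat.dvd_gcd (Int.natCast_dvd.1 h) dvd_rfl))
    omega

/-- If `q ∣ d` and `q ∤ d'` for some prime `q`, then `ℚ(√d)` does not embed into the finite adeles
of `ℚ(√d')`. -/
theorem isEmpty_ringHom_finiteAdeles (hL : Module.finrank ℚ L = 2) {d d' : ℤ} (hd : Squarefree d)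
    {δ : K} (hδ : IsSqrtGenerator d δ) {δ' : 𝓞 L} (hδ' : IsSqrtGenerator d' (δ' : L)) {q : ℕ}
    (hq : q.Prime) (hqd : (q : ℤ) ∣ d) (hqd' : ¬ (q : ℤ) ∣ d') :
    IsEmpty (K →+* FiniteAdeles L) := by
  refine ⟨fun φ => ?_⟩
  obtain ⟨N, hN⟩ := hδ'.exists_forall_jacobiSym_ne hL
  obtain ⟨e, rfl⟩ := hqd
  have hqe : ¬ (q : ℤ) ∣ e := fun h =>
    (Nat.prime_iff_prime_int.1 hq).not_isUnit (hd q (mul_dvd_mul_left _ h))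
  obtain ⟨p, hp, hpp, h1, h2⟩ := exists_prime_jacobiSym_eq_neg_one_and_eq_one hq hqe hqd' N
  exact hN p hp hpp h2 _ (φ δ) (by rw [← map_pow, hδ.sq_eq, map_intCast]) h1

theorem eq_of_squarefree_of_neg {d d' : ℤ} (hd : Squarefree d) (hd' : Squarefree d') (hneg : d < 0)
    (hneg' : d' < 0) (h : ∀ q : ℕ, q.Prime → ((q : ℤ) ∣ d ↔ (q : ℤ) ∣ d')) : d = d' := by
  have : d.natAbs = d'.natAbs :=
    (Nat.Squarefree.ext_iff (Int.squarefree_natAbs.2 hd) (Int.squarefree_natAbs.2 hd')).2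
      fun q hq => by simpa only [Int.natCast_dvd] using h q hq
  omega

/-- For non-isomorphic imaginary quadratic fields, one of the fields does not embed into the finite
adeles of the other one. -/
theorem IsImaginaryQuadratic.isEmpty_ringHom (hK : IsImaginaryQuadratic K)
    (hL : IsImaginaryQuadratic L) (h : IsEmpty (K ≃+* L)) :
    IsEmpty (K →+* FiniteAdeles L) ∨ IsEmpty (L →+* FiniteAdeles K) := by
  obtain ⟨d, δ, hd, hneg, hδ⟩ := hK.exists_isSqrtGenerator
  obtain ⟨d', δ', hd', hneg', hδ'⟩ := hL.exists_isSqrtGenerator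
  have hne : d ≠ d' := by
    rintro rfl
    exact (hδ.nonempty_ringEquiv hδ' hneg).elim h.false
  have h1 : ∃ q : ℕ, q.Prime ∧ ¬ ((q : ℤ) ∣ d ↔ (q : ℤ) ∣ d') := by
    by_contra! h1
    exact hne (eq_of_squarefree_of_neg hd hd' hneg hneg' h1)
  obtain ⟨q, hq, hqd⟩ := h1
  by_cases h2 : (q : ℤ) ∣ d
  · exact .inl (isEmpty_ringHom_finiteAdeles hL.1 hd hδ hδ' hq h2 (by tauto))
  · exact .inr (isEmpty_ringHom_finiteAdeles hK.1 hd' hδ' hδ hq (by tauto) h2)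

end Main

end

theorem mainTheorem8 {K : Type*} [Field K] [NumberField K] {L : Type*} [Field L] [NumberField L]
    (hK : IsImaginaryQuadratic K) (hL : IsImaginaryQuadratic L)
    (hK₁ : IsEmpty (K ≃+* QI)) (hK₂ : IsEmpty (K ≃+* QSqrtNegTwo))
    (hL₁ : IsEmpty (L ≃+* QI)) (hL₂ : IsEmpty (L ≃+* QSqrtNegTwo)) :
    (∀ r s : ℕ,
      Nonempty (AddMulPoints (FiniteAdeles K) r s ≃ₜ* AddMulPoints (FiniteAdeles L) r s) ∧
      Nonempty (AddMulPoints (Adeles K) r s ≃ₜ* AddMulPoints (Adeles L) r s)) ∧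
    (IsEmpty (K ≃+* L) →
      IsEmpty (FiniteAdeles K ≃+* FiniteAdeles L) ∧ IsEmpty (Adeles K ≃+* Adeles L)) := by
  have ha := FiniteAdeles.nonempty_continuousAddEquiv hK.1 hL.1
  have hu := FiniteAdeles.nonempty_units_continuousMulEquiv hK hL hK₁ hK₂ hL₁ hL₂
  refine ⟨fun r s => ⟨nonempty_addMulPoints_equiv ha hu r s,
    nonempty_addMulPoints_equiv (ha.elim (Adeles.nonempty_continuousAddEquiv hK hL))
      (hu.elim (Adeles.nonempty_units_continuousMulEquiv hK hL)) r s⟩, fun h => ⟨⟨fun φ => ?_⟩,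
        ⟨fun φ => ?_⟩⟩⟩
  · rcases hK.isEmpty_ringHom hL h with h1 | h1
    · exact h1.false (φ.toRingHom.comp (algebraMap K _))
    · exact h1.false (φ.symm.toRingHom.comp (algebraMap L _))
  · rcases hK.isEmpty_ringHom hL h with h1 | h1
    · exact h1.false ((RingHom.snd (NumberField.InfiniteAdeleRing L) (FiniteAdeles L)).comp
        (φ.toRingHom.comp (algebraMap K (Adeles K))))
    · exact h1.false ((RingHom.snd (NumberField.InfiniteAdeleRing K) (FiniteAdeles K)).comp
        (φ.symm.toRingHom.comp (algebraMap L (Adeles L))))
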